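/- Let $\mathcal C$ be the class of all finite groups $G$ such that every section $S/K$ of $G$ ($K\trianglelefteq S\le G$) is abelian or contains a non-central abelian normal subgroup. Let $G\in\mathcal C$. *Character triples.* For $N\trianglelefteq G$, an $N$-linear character triple of $G$ is a triple $(H,A,\vartheta)$ with $A\trianglelefteq H\le G$ and $\vartheta$ an $H$-invariant linear complex character of $A$ such that $\ker\vartheta^{G}=N$, where $\vartheta^G$ is the character induced to $G$. For each such triple fix a normal subgroup $\mathcal A$ of $H$ of maximal order among those that contain $\ker\vartheta$ and for which $\mathcal A/\ker\vartheta$ is abelian. On the set of linear characters $\varphi$ of $\mathcal A$ with $\varphi|_A=\vartheta$ and $\ker\varphi^{G}=N$ the group $\operatorname{Aut}(\mathbb C|\vartheta)\times H$ acts, where $\operatorname{Aut}(\mathbb C|\vartheta)$ is the group of field automorphisms of $\mathbb C$ fixing the values of $\vartheta$, acting by composition, and $H$ acts by conjugation; fix a set $\mathfrak{Lin}(\mathcal A|\vartheta)$ of representatives of its orbits. The direct Clifford correspondents of $(H,A,\vartheta)$ are the triples $(I_H(\varphi),\mathcal A,\varphi)$, $\varphi\in\mathfrak{Lin}(\mathcal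 A|\vartheta)$, with $I_H(\varphi)$ the inertia group of $\varphi$ in $H$, if $H\ne A$; there are none if $H=A$. *The graph.* Let $\mathcal G_N$ be the directed graph whose vertices are the $N$-linear character triples of $G$ that can be reached from $(G,N,1_N)$ by a directed path, where $(u,v)$ is an edge if $v$ is a direct Clifford correspondent of $u$. A rooted directed tree is a directed graph without loops or pairs of opposite edges whose underlying undirected graph is a tree and which has a unique source (vertex of in-degree $0$), its root; its leaves are the vertices of out-degree $0$. *Shoda pairs.* A pair $(H,K)$ of subgroups of $G$ is a Shoda pair of $G$ if $K\trianglelefteq H$, $H/K$ is cyclic, and $g\in H$ for every $g\in G$ such that $\{h^{-1}g^{-1}hg : h\in H\}\cap H\subseteq K$. For $L\le G$ put $\widehat L=\frac1{|L|}\sum_{l\in L}l\in\mathbb QG$, put $\varepsilon(H,H)=\widehat H$ and, for $K\ne H$, $\varepsilon(H,K)=\prod_L(\widehat K-\widehat L)$ over the minimal normal subgroups $L$ of $H$ containing $K$ properly, and let $e(G,H,K)$ be the sum of the distinct $G$-conjugates of $\varepsilon(H,K)$. The pair $(H,K)$ realizes the primitive central idempotent $f$ of $\mathbb QG$ if $f=\alpha\,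 e(G,H,K)$ for some $\alpha\in\mathbb Q$. **Theorem.** Let $G\in\mathcal C$. Whatever choices of the subgroups $\mathcal A$ and of the sets $\mathfrak{Lin}(\mathcal A|\vartheta)$ are fixed, the following hold. (i) For every normal subgroup $N$ of $G$: (a) $\mathcal G_N$ is a rooted directed tree with root $(G,N,1_N)$; (b) if $(H,H,\vartheta)$ is a leaf of $\mathcal G_N$, then $(H,\ker\vartheta)$ is a Shoda pair of $G$. (ii) If $(H',K')$ is a Shoda pair of $G$ and $N=\operatorname{core}_G(K')$, the largest normal subgroup of $G$ contained in $K'$, then there is a leaf $(H,H,\vartheta)$ of $\mathcal G_N$ such that $(H',K')$ and $(H,\ker\vartheta)$ realize the same primitive central idempotent of $\mathbb QG$. -/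

import Mathlib

noncomputable section

namespace ShodaTree

/-! ### The class of groups -/

/-- A group is abelian or it contains a non-central abelian normal subgroup. -/
def AbelianOrNoncentral (Q : Type*) [Group Q] : Prop :=
  (∀ a b : Q, a * b = b * a) ∨
    ∃ B : Subgroup Q, B.Normal ∧ (∀ x ∈ B, ∀ y ∈ B, x * y = y * x) ∧ ¬ B ≤ Subgroup.center Q

/-- The class `𝒞` (for finite groups): every quotient group of every subgroup of `G` is abelian
or contains a non-central abelian normal subgroup. -/
def ClassC (G : Type*) [Group G] : Prop :=
  ∀ (H : Subgroup G) (K : Subgroup H) [K.Normal], AbelianOrNoncentral (H ⧸ K)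

section Group

variable {G : Type*} [Group G]

/-- `B` is a normal subgroup of `H`. -/
def NormalIn (B H : Subgroup G) : Prop :=
  B ≤ H ∧ ∀ h ∈ H, ∀ b ∈ B, h * b * h⁻¹ ∈ B

/-! ### Linear characters

A linear character of `A` is a homomorphism `A →* ℂˣ`. -/

/-- The kernel of a linear character of a subgroup, as a subgroup of the whole group. -/
def kerIn {A : Subgroup G} (θ : A →* ℂˣ) : Subgroup G := θ.ker.map A.subtype

/-- `φ ^ g = φ`, where `φ ^ g (a) = φ (g a g⁻¹)`, for `g` that normalizes the domain of `φ`. -/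
def Fixes {A : Subgroup G} (g : G) (φ : A →* ℂˣ) : Prop :=
  ∀ a b : A, (b : G) = g * a * g⁻¹ → φ b = φ a

open Classical in
/-- The character of `G` induced by the linear character `θ` of the subgroup `A`. -/
def inducedChar [Fintype G] {A : Subgroup G} (θ : A →* ℂˣ) (g : G) : ℂ :=
  (Nat.card A : ℂ)⁻¹ *
    ∑ x : G, if h : x * g * x⁻¹ ∈ A then ((θ ⟨x * g * x⁻¹, h⟩ : ℂˣ) : ℂ) else 0

/-- The kernel `{g | θ^G (g) = θ^G (1)}` of the induced character. -/
def inducedKer [Fintype G] {A : Subgroup G} (θ : A →* ℂˣ) : Set G :=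
  {g | inducedChar θ g = inducedChar θ 1}

/-- The inertia group `I_H(φ)` of a linear character `φ` of a normal subgroup `A` of `H`. -/
def inertia {H A : Subgroup G} (hA : NormalIn A H) (φ : A →* ℂˣ) : Subgroup G where
  carrier := {g | g ∈ H ∧ Fixes g φ}
  one_mem' := ⟨H.one_mem, fun a b hb => by
    have : b = a := Subtype.ext (by simpa using hb)
    rw [this]⟩
  mul_mem' := by
    rintro x y ⟨hx, fx⟩ ⟨hy, fy⟩
    refine ⟨H.mul_mem hx hy, fun a b hb => ?_⟩
    have hc := hA.2 y hy a a.2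
    rw [fx ⟨_, hc⟩ b (by rw [hb]; group), fy a ⟨_, hc⟩ rfl]
  inv_mem' := by
    rintro x ⟨hx, fx⟩
    refine ⟨H.inv_mem hx, fun a b hb => ?_⟩
    exact (fx b a (by rw [hb]; group)).symm

/-! ### Linear character triples -/

variable (G) in
/-- A character triple `(H, A, θ)` with `θ` linear: `H` is a subgroup of `G`, `A` is a normal
subgroup of `H`, and `θ` is a linear character of `A` invariant in `H`. -/
@[ext] structure LinearTriple where
  H : Subgroup G
  A : Subgroup G
  θ : A →* ℂˣ
  normal : NormalIn A H
  invariant : ∀ h ∈ H, Fixes h θ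

/-- The triple is an `N`-linear character triple of `G`: the kernel of `θ^G` is `N`. -/
def LinearTriple.IsNLinear [Fintype G] (u : LinearTriple G) (N : Subgroup G) : Prop :=
  inducedKer u.θ = (N : Set G)

/-- `B` is a normal subgroup of `H` containing `ker θ` with `B / ker θ` abelian
(the latter is expressed by `[B, B] ≤ ker θ`). -/
def IsAbelianOver (u : LinearTriple G) (B : Subgroup G) : Prop :=
  NormalIn B u.H ∧ kerIn u.θ ≤ B ∧ ⁅B, B⁆ ≤ kerIn u.θ

/-- An admissible subgroup `𝒜_{(H,A,θ)}`: a normal subgroup of `H` containing `ker θ`, with abelian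
quotient by `ker θ`, of maximal order among these. -/
def IsMaxAbelianOver (u : LinearTriple G) (B : Subgroup G) : Prop :=
  IsAbelianOver u B ∧ ∀ C : Subgroup G, IsAbelianOver u C → Nat.card C ≤ Nat.card B

/-- The linear characters `φ` of `B` that lie above `θ` and satisfy `ker φ^G = ker θ^G`
(the latter is `N` if the triple is `N`-linear). -/
def linAbove [Fintype G] (u : LinearTriple G) (B : Subgroup G) : Set (B →* ℂˣ) :=
  {φ | (∃ h : u.A ≤ B, φ.comp (Subgroup.inclusion h) = u.θ) ∧ inducedKer φ = inducedKer u.θ}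

/-- `ψ = σ ∘ φ ^ h` for some `h ∈ H` and some automorphism `σ` of the field `ℂ` fixing all values
of `θ`, hence fixing `ℚ(θ)`: the two characters lie in one orbit of `Aut(ℂ|θ) × H`. -/
def SameOrbit (u : LinearTriple G) {B : Subgroup G} (φ ψ : B →* ℂˣ) : Prop :=
  ∃ σ : ℂ ≃+* ℂ, (∀ a : u.A, σ (u.θ a : ℂˣ) = (u.θ a : ℂˣ)) ∧
    ∃ h ∈ u.H, ∀ a b : B, (b : G) = h * a * h⁻¹ → ((ψ a : ℂˣ) : ℂ) = σ (φ b : ℂˣ)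

variable (G) in
/-- The choices made in the construction of direct Clifford correspondents: for every triple an
admissible subgroup `𝒜`, and a set of representatives of the distinct orbits of `Aut(ℂ|θ) × H` on
the set of linear characters of `𝒜` above `θ` with the right induced kernel. -/
structure CliffordChoice [Fintype G] where
  sub : LinearTriple G → Subgroup G
  sub_spec : ∀ u, IsMaxAbelianOver u (sub u)
  reps : ∀ u, Set (sub u →* ℂˣ)
  reps_subset : ∀ u, reps u ⊆ linAbove u (sub u)
  reps_spec : ∀ u, ∀ φ ∈ linAbove u (sub u), ∃! ψ, ψ ∈ reps u ∧ SameOrbit u ψ φ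

theorem isAbelianOver_kerIn (u : LinearTriple G) : IsAbelianOver u (kerIn u.θ) := by
  have mem : ∀ g, g ∈ kerIn u.θ ↔ ∃ h : g ∈ u.A, u.θ ⟨g, h⟩ = 1 := by
    intro g; simp [kerIn, Subgroup.mem_map, MonoidHom.mem_ker]
  refine ⟨⟨?_, ?_⟩, le_rfl, ?_⟩
  · intro g hg
    obtain ⟨h, -⟩ := (mem g).1 hg
    exact u.normal.1 h
  · intro h hh b hb
    obtain ⟨hb, e⟩ := (mem b).1 hb
    exact (mem _).2 ⟨u.normal.2 h hh b hb, by rw [u.invariant h hh ⟨b, hb⟩ ⟨_, u.normal.2 h hh b hb⟩ rfl, e]⟩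
  · exact Subgroup.commutator_le.2 fun a ha b hb => by
      rw [commutatorElement_def]
      exact mul_mem (mul_mem (mul_mem ha hb) (inv_mem ha)) (inv_mem hb)

theorem exists_isMaxAbelianOver [Finite G] (u : LinearTriple G) : ∃ B, IsMaxAbelianOver u B := by
  classical
  obtain ⟨B, hB, hm⟩ := (Set.toFinite {B | IsAbelianOver u B}).exists_maximalFor (fun B : Subgroup G => Nat.card B) _
    (⟨kerIn u.θ, isAbelianOver_kerIn u⟩ : {B | IsAbelianOver u B}.Nonempty)
  refine ⟨B, hB, fun C hC => ?_⟩
  by_contra h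
  exact h (hm hC (by simpa using (le_of_lt (not_le.1 h))))

theorem sameOrbit_equivalence (u : LinearTriple G) (B : Subgroup G) (hB : NormalIn B u.H) :
    Equivalence (SameOrbit u (B := B)) where
  refl φ := ⟨RingEquiv.refl ℂ, fun _ => rfl, 1, u.H.one_mem, fun a b h => by
    have : b = a := Subtype.ext (by simpa using h)
    rw [this]; rfl⟩
  symm := by
    rintro φ ψ ⟨σ, hσ, h, hh, e⟩
    refine ⟨σ.symm, fun a => by rw [RingEquiv.symm_apply_eq]; exact (hσ a).symm, h⁻¹, u.H.inv_mem hh, fun a b hb => ?_⟩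
    rw [e b a (by rw [hb]; group)]; simp
  trans := by
    rintro φ ψ χ ⟨σ, hσ, h, hh, e⟩ ⟨τ, hτ, k, hk, f⟩
    refine ⟨σ.trans τ, fun a => by simp [hσ, hτ], h * k, u.H.mul_mem hh hk, fun a b hb => ?_⟩
    have hc := hB.2 k hk a a.2
    rw [f a ⟨_, hc⟩ rfl, e ⟨_, hc⟩ b (by rw [hb]; group)]; rfl

/-- The choices above can be made for every finite group. -/
theorem CliffordChoice.nonempty [Fintype G] : Nonempty (CliffordChoice G) := by
  classical
  choose sub hs using exists_isMaxAbelianOver (G := G)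
  let S : ∀ u, Setoid (linAbove u (sub u)) := fun u =>
    ⟨fun φ ψ => SameOrbit u φ.1 ψ.1, ⟨fun _ => (sameOrbit_equivalence u _ (hs u).1.1).refl _,
      fun h => (sameOrbit_equivalence u _ (hs u).1.1).symm h, fun h h' => (sameOrbit_equivalence u _ (hs u).1.1).trans h h'⟩⟩
  refine ⟨⟨sub, hs, fun u => Set.range fun q : Quotient (S u) => (q.out).1, ?_, ?_⟩⟩
  · rintro u _ ⟨q, rfl⟩; exact q.out.2
  · intro u φ hφ
    refine ⟨(Quotient.mk (S u) ⟨φ, hφ⟩).out.1, ⟨⟨_, rfl⟩, Quotient.mk_out (s := S u) ⟨φ, hφ⟩⟩, ?_⟩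
    rintro _ ⟨⟨q, rfl⟩, h⟩
    have : q = Quotient.mk (S u) ⟨φ, hφ⟩ := by
      rw [← q.out_eq]; exact Quotient.sound (s := S u) h
    rw [this]

/-- The triple `(I_H(φ), B, φ)` for a linear character `φ` of a normal subgroup `B` of `H`. -/
def inertiaTriple {H B : Subgroup G} (hB : NormalIn B H) (φ : B →* ℂˣ)
    (hφ : ∀ g ∈ B, Fixes g φ) : LinearTriple G where
  H := inertia hB φ
  A := B
  θ := φ
  normal := ⟨fun b hb => ⟨hB.1 hb, hφ b hb⟩, fun h hh b hb => hB.2 h hh.1 b hb⟩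
  invariant := fun _ hh => hh.2

/-- A linear character is fixed by the elements of its domain. -/
theorem fixes_of_mem {B : Subgroup G} (φ : B →* ℂˣ) (g : G) (hg : g ∈ B) : Fixes g φ := by
  intro a b hb
  have : b = ⟨g, hg⟩ * a * ⟨g, hg⟩⁻¹ := Subtype.ext (by simpa using hb)
  rw [this, map_mul, map_mul, map_inv, mul_comm, inv_mul_cancel_left]

/-- The set `Cl(H, A, θ)` of direct Clifford correspondents; it is empty if `H = A`. -/
def CliffordChoice.Cl [Fintype G] (c : CliffordChoice G) (u : LinearTriple G) :
    Set (LinearTriple G) :=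
  {v | u.H ≠ u.A ∧ ∃ φ ∈ c.reps u,
    v = inertiaTriple (c.sub_spec u).1.1 φ (fixes_of_mem φ)}

/-! ### The directed graph of triples -/

/-- The directed graph whose vertices are all `N`-linear character triples of `G`, with an edge
`(u, v)` if `v` is a direct Clifford correspondent of `u`. -/
def tripleDigraph [Fintype G] (c : CliffordChoice G) (N : Subgroup G) :
    Digraph {u : LinearTriple G // u.IsNLinear N} where
  Adj u v := v.1 ∈ c.Cl u.1

/-- The triple `(G, N, 1_N)`. -/
def trivTriple (N : Subgroup G) [N.Normal] : LinearTriple G where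
  H := ⊤
  A := N
  θ := 1
  normal := ⟨le_top, fun h _ b hb => Subgroup.Normal.conj_mem ‹_› b hb h⟩
  invariant := fun _ _ _ _ _ => rfl

theorem trivTriple_isNLinear [Fintype G] (N : Subgroup G) [hN : N.Normal] :
    (trivTriple N).IsNLinear N := by
  classical
  have key : ∀ (g x : G), x * g * x⁻¹ ∈ N ↔ g ∈ N := fun g x =>
    ⟨fun h => by simpa [mul_assoc] using hN.conj_mem _ h x⁻¹, fun h => hN.conj_mem _ h x⟩
  have val : ∀ g : G, inducedChar (1 : N →* ℂˣ) g =
      (Nat.card N : ℂ)⁻¹ * if g ∈ N then (Fintype.card G : ℂ) else 0 := by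
    intro g
    unfold inducedChar
    by_cases hg : g ∈ N <;> simp [key, hg]
  ext g
  change inducedChar (1 : N →* ℂˣ) g = inducedChar (1 : N →* ℂˣ) 1 ↔ g ∈ N
  rw [val, val]
  by_cases hg : g ∈ N <;> simp [hg, N.one_mem]

/-- The vertex `(G, N, 1_N)`. -/
def rootVertex [Fintype G] (N : Subgroup G) [N.Normal] :
    {u : LinearTriple G // u.IsNLinear N} :=
  ⟨trivTriple N, trivTriple_isNLinear N⟩

/-- The vertices of `𝒢_N`: the `N`-linear triples to which there is a directed path from
`(G, N, 1_N)`. -/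
abbrev TreeVertex [Fintype G] (c : CliffordChoice G) (N : Subgroup G) [N.Normal] : Type _ :=
  {v : {u : LinearTriple G // u.IsNLinear N} //
    Relation.ReflTransGen (tripleDigraph c N).Adj (rootVertex N) v}

/-- The directed graph `𝒢_N`. -/
def treeDigraph [Fintype G] (c : CliffordChoice G) (N : Subgroup G) [N.Normal] :
    Digraph (TreeVertex c N) where
  Adj u v := (tripleDigraph c N).Adj u.1 v.1

/-- `(G, N, 1_N)` as a vertex of `𝒢_N`. -/
def treeRoot [Fintype G] (c : CliffordChoice G) (N : Subgroup G) [N.Normal] : TreeVertex c N :=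
  ⟨rootVertex N, Relation.ReflTransGen.refl⟩

end Group

/-! ### Rooted directed trees -/

/-- A vertex of in-degree zero. -/
def IsSource {V : Type*} (D : Digraph V) (v : V) : Prop := ∀ u, ¬ D.Adj u v

/-- A vertex of out-degree zero; the leaves of a directed tree are its sinks. -/
def IsSink {V : Type*} (D : Digraph V) (v : V) : Prop := ∀ w, ¬ D.Adj v w

/-- A directed graph is a directed tree if it has no loops and no pairs of opposite edges and its
underlying undirected graph is a tree. -/
def IsDirectedTree {V : Type*} (D : Digraph V) : Prop :=
  (∀ u v, D.Adj u v → ¬ D.Adj v u) ∧ D.toSimpleGraphInclusive.IsTree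

/-- A rooted directed tree with root `r`: a directed tree whose unique source is `r`. -/
def IsRootedDirectedTree {V : Type*} (D : Digraph V) (r : V) : Prop :=
  IsDirectedTree D ∧ ∀ v, IsSource D v ↔ v = r

/-! ### Shoda pairs and the primitive central idempotents they realize -/

section Idempotents

variable {G : Type*} [Group G]

/-- Shoda pairs `(H, K)` of `G`: `K` is normal in `H`, `H / K` is cyclic, and whenever all
commutators `[h, g] = h⁻¹ g⁻¹ h g`, `h ∈ H`, that lie in `H` lie in `K`, then `g ∈ H`. -/
def IsShodaPair (H K : Subgroup G) : Prop :=
  K ≤ H ∧ (∃ _ : (K.subgroupOf H).Normal, IsCyclic (H ⧸ K.subgroupOf H)) ∧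
    ∀ g : G, (∀ h ∈ H, h⁻¹ * g⁻¹ * h * g ∈ H → h⁻¹ * g⁻¹ * h * g ∈ K) → g ∈ H

variable [Fintype G]

open Classical in
/-- The element `(1 / |H|) ∑_{h ∈ H} h` of `ℚG`. -/
def hat (H : Subgroup G) : MonoidAlgebra ℚ G :=
  (Nat.card H : ℚ)⁻¹ • ∑ h : G with h ∈ H, MonoidAlgebra.of ℚ G h

open Classical in
theorem of_mul_hat {H : Subgroup G} (x : G) (hx : ∀ h, x * h * x⁻¹ ∈ H ↔ h ∈ H) :
    MonoidAlgebra.of ℚ G x * hat H = hat H * MonoidAlgebra.of ℚ G x := by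
  unfold hat
  rw [mul_smul_comm, smul_mul_assoc, Finset.mul_sum, Finset.sum_mul]
  congr 1
  refine Finset.sum_bij (fun h _ => x * h * x⁻¹) ?_ ?_ ?_ ?_
  · intro h hh
    simpa [hx h] using hh
  · intro a _ b _ hab
    simpa using hab
  · intro b hb
    refine ⟨x⁻¹ * b * x, ?_, by group⟩
    have := hx (x⁻¹ * b * x)
    have e : x * (x⁻¹ * b * x) * x⁻¹ = b := by group
    rw [e] at this
    simpa [← this] using hb
  · intro h _
    rw [← map_mul, ← map_mul]
    congr 1
    group

open Classical in
theorem hat_comm {H L M : Subgroup G} (hL : L ≤ H) (hM : NormalIn M H) :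
    Commute (hat L) (hat M) := by
  have key : ∀ x ∈ L, MonoidAlgebra.of ℚ G x * hat M = hat M * MonoidAlgebra.of ℚ G x := by
    intro x hx
    refine of_mul_hat x fun h => ⟨fun hh => ?_, fun hh => hM.2 x (hL hx) h hh⟩
    have := hM.2 x⁻¹ (H.inv_mem (hL hx)) _ hh
    simpa [mul_assoc] using this
  change hat L * hat M = hat M * hat L
  conv_lhs => rw [hat, smul_mul_assoc, Finset.sum_mul]
  conv_rhs => rw [hat.eq_1 L, mul_smul_comm, Finset.mul_sum]
  congr 1
  refine Finset.sum_congr rfl fun x hx => key x ?_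
  simpa using hx

/-- `L` is minimal among the normal subgroups of `H` that properly contain `K`. -/
def IsMinNormalOver (H K L : Subgroup G) : Prop :=
  Minimal (fun M : Subgroup G => NormalIn M H ∧ K < M) L

open Classical in
/-- The factors of `ε(H, K)` commute, so that their product does not depend on an order. -/
theorem eps_comm (H K : Subgroup G) :
    (((Finset.univ.filter (IsMinNormalOver H K) : Finset (Subgroup G)) : Set (Subgroup G))).Pairwise
      (Function.onFun Commute fun L => hat K - hat L) := by
  intro L hL M hM _
  have hL' : IsMinNormalOver H K L := by simpa using hL
  have hM' : IsMinNormalOver H K M := by simpa using hM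
  have h1 := hat_comm (hL'.1.2.le.trans hL'.1.1.1) hM'.1.1
  have h2 := hat_comm (hL'.1.2.le.trans hL'.1.1.1) hL'.1.1
  have h3 := hat_comm hL'.1.1.1 hM'.1.1
  exact ((Commute.refl _).sub_right h1).sub_left (h2.symm.sub_right h3)

open Classical in
/-- The element `ε(H, K)` of `ℚG`: it is the hat of `K` if `H = K`, and otherwise the product of
the differences of the hats of `K` and `L`, over the minimal normal subgroups `L` of `H`
that contain `K` properly. -/
def eps (H K : Subgroup G) : MonoidAlgebra ℚ G :=
  if H = K then hat K
  else (Finset.univ.filter (IsMinNormalOver H K)).noncommProd (fun L => hat K - hat L)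
    (eps_comm H K)

open Classical in
/-- The element `e(G, H, K)` of `ℚG`: the sum of the distinct `G`-conjugates of `ε(H, K)`. -/
def conjSum (H K : Subgroup G) : MonoidAlgebra ℚ G :=
  ∑ f ∈ Finset.univ.image
    (fun g : G => MonoidAlgebra.of ℚ G g⁻¹ * eps H K * MonoidAlgebra.of ℚ G g), f

/-- A central idempotent of a ring. -/
def IsCentralIdempotent {R : Type*} [Ring R] (e : R) : Prop :=
  IsIdempotentElem e ∧ ∀ x, e * x = x * e

/-- A primitive central idempotent: a nonzero central idempotent that is not the sum of two
nonzero orthogonal central idempotents. -/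
def IsPrimitiveCentralIdempotent {R : Type*} [Ring R] (e : R) : Prop :=
  IsCentralIdempotent e ∧ e ≠ 0 ∧
    ∀ e₁ e₂ : R, IsCentralIdempotent e₁ → IsCentralIdempotent e₂ → e₁ * e₂ = 0 → e = e₁ + e₂ →
      e₁ = 0 ∨ e₂ = 0

/-- The primitive central idempotent `f` of `ℚG` is realized by the pair `(H, K)`:
`f = α e(G, H, K)` for a rational number `α`. -/
def Realizes (H K : Subgroup G) (f : MonoidAlgebra ℚ G) : Prop :=
  IsPrimitiveCentralIdempotent f ∧ ∃ α : ℚ, f = α • conjSum H K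

end Idempotents

end ShodaTree

end

noncomputable section

namespace ShodaTree

-- Tree. A direct Clifford correspondent extends the character of its source, so `Extends` holds
-- along directed paths. Siblings carry characters of the same subgroup `𝒜`, hence a triple extends
-- at most one of them; so all vertices with paths to a given vertex are comparable, and parents are
-- unique. Since `θ` is `H`-invariant, `A/ker θ` is central in `H/ker θ`; maximality of `𝒜` gives `A
-- ≤ 𝒜`, and the hypothesis on `G` makes this strict when `H ≠ A`
-- (`LinearTriple.lt_of_isMaxAbelianOver`). Thus `|A|` is a rank that increases along edges, which
-- excludes cycles.
--
-- Leaves. If `g` stabilizes the character at a vertex, in the sense of Mackey's criterion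
-- (agreement wherever both the character and its conjugate are defined), then it stabilizes all
-- restrictions along the path, so it stays in every inertia group passed (`mem_H_of_fixes`). When
-- `H = A` this is the Shoda condition.
--
-- Completeness. Let `e_θ` be the idempotent of `ℂG` given by a linear character. For a Shoda pair
-- `(H, ker l)`, Mackey's criterion gives `e_l ℂG e_l = ℂ e_l`, so central elements act on `e_l` by
-- scalars. A rational element killing `e_l` kills `e_μ` for all `μ` with the same kernel, and `ε(H,
-- ker l)` is the sum of these `e_μ`. Hence a rational multiple of `e(G, H, ker l)` is a primitive
-- central idempotent `f` with `f e_l = e_l` (`exists_realizes_of_isShodaPair`). Now keep `f e_θ ≠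
-- 0` while descending from the root: `e_θ` is a sum of `e_φ` over extensions `φ` to `𝒜`, some `f
-- e_φ` is nonzero, primitivity of `f` forces the right induced kernel, and passing to an orbit
-- representative is harmless because `f` is rational and central. At the leaf reached, the
-- idempotent `f'` realized there satisfies `f f' ≠ 0`, so `f = f'`.

universe u

open scoped commutatorElement

/-! ### Rooted directed trees from a rank function -/

section Digraphs

variable {V : Type*} {D : Digraph V} {r : V}

theorem rank_le_of_reflTransGen {rank : V → ℕ} (hrank : ∀ u v, D.Adj u v → rank u < rank v)
    {u v : V} (h : Relation.ReflTransGen D.Adj u v) : rank u ≤ rank v := by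
  induction h with
  | refl => exact le_rfl
  | tail _ hb ih => exact ih.trans (hrank _ _ hb).le

/-- A digraph with a strictly increasing rank, in which parents are unique and every vertex is
reachable from `r`, is a rooted directed tree with root `r`. -/
theorem isRootedDirectedTree_of_rank (rank : V → ℕ) (hrank : ∀ u v, D.Adj u v → rank u < rank v)
    (huniq : ∀ u u' v, D.Adj u v → D.Adj u' v → u = u')
    (hreach : ∀ v, Relation.ReflTransGen D.Adj r v) : IsRootedDirectedTree D r := by
  classical
  refine ⟨⟨fun u v h h' => (hrank _ _ h).asymm (hrank _ _ h'), ?_⟩, fun v => ⟨fun h => ?_, ?_⟩⟩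
  · have hr : ∀ v, D.toSimpleGraphInclusive.Reachable r v := by
      intro v
      induction hreach v with
      | refl => exact SimpleGraph.Reachable.refl _
      | tail _ hb ih =>
        refine ih.trans (SimpleGraph.Adj.reachable ?_)
        exact ⟨fun e => (hrank _ _ hb).ne (by rw [e]), Or.inl hb⟩
    have : Nonempty V := ⟨r⟩
    refine ⟨SimpleGraph.Connected.mk fun u v => (hr u).symm.trans (hr v), ?_⟩
    intro v p hp
    -- Both neighbours on the cycle of a vertex of maximal rank must be its parents, so they
    -- coincide, which is impossible in a cycle.
    obtain ⟨w, hw, hmax⟩ := p.support.toFinset.exists_max_image rank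
      ⟨v, by simp⟩
    have hw' : w ∈ p.support := by simpa using hw
    have hq := hp.rotate hw'
    set q := p.rotate w hw' with hqdef
    have hmax' : ∀ x ∈ q.support, rank x ≤ rank w := by
      intro x hx
      refine hmax x ?_
      simpa using (SimpleGraph.Walk.mem_support_rotate_iff p w hw').1 hx
    have parent : ∀ x ∈ q.support, D.toSimpleGraphInclusive.Adj w x → D.Adj x w := by
      intro x hx hadj
      rcases hadj.2 with h | h
      · exact absurd (hmax' x hx) (not_le.2 (hrank _ _ h))
      · exact h
    refine hq.snd_ne_penultimate (huniq _ _ w (parent _ ?_ ?_) (parent _ ?_ ?_))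
    · exact q.getVert_mem_support _
    · exact q.adj_snd hq.not_nil
    · exact q.getVert_mem_support _
    · exact (q.adj_penultimate hq.not_nil).symm
  · rcases (hreach v).cases_tail with e | ⟨u, -, hu⟩
    · exact e
    · exact absurd hu (h u)
  · rintro rfl u hu
    exact (hrank _ _ hu).not_ge (rank_le_of_reflTransGen hrank (hreach u))

end Digraphs

/-! ### Induced kernels and maximal abelian normal sections -/

section Group

variable {G : Type*} [Group G]

theorem mem_kerIn {A : Subgroup G} {θ : A →* ℂˣ} {g : G} :
    g ∈ kerIn θ ↔ ∃ h : g ∈ A, θ ⟨g, h⟩ = 1 := by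
  simp [kerIn, Subgroup.mem_map, MonoidHom.mem_ker]

theorem kerIn_le {A : Subgroup G} (θ : A →* ℂˣ) : kerIn θ ≤ A := fun _ hg => (mem_kerIn.1 hg).1

theorem norm_apply_eq_one [Finite G] {A : Subgroup G} (θ : A →* ℂˣ) (a : A) :
    ‖((θ a : ℂˣ) : ℂ)‖ = 1 := by
  refine Complex.norm_eq_one_of_pow_eq_one (n := Nat.card A) ?_ Nat.card_pos.ne'
  rw [← Units.val_pow_eq_pow_val, ← map_pow, pow_card_eq_one', map_one, Units.val_one]

/-- The induced value is an average of terms that are roots of unity or zero. Their real parts are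
at most 1, so the value at the identity is attained only if every term equals 1. -/
theorem mem_inducedKer [Fintype G] {A : Subgroup G} {θ : A →* ℂˣ} {g : G} :
    g ∈ inducedKer θ ↔ ∀ x, x * g * x⁻¹ ∈ kerIn θ := by
  classical
  let t : G → G → ℂ := fun g x =>
    if h : x * g * x⁻¹ ∈ A then ((θ ⟨x * g * x⁻¹, h⟩ : ℂˣ) : ℂ) else 0
  have t_eq : ∀ g x, x * g * x⁻¹ ∈ kerIn θ → t g x = 1 := by
    intro g x hx
    obtain ⟨h, e⟩ := mem_kerIn.1 hx
    simp [t, h, e]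
  have t_le : ∀ g x, (t g x).re ≤ 1 := by
    intro g x
    by_cases h : x * g * x⁻¹ ∈ A
    · simp only [t, h, dif_pos]
      exact (Complex.re_le_norm _).trans (norm_apply_eq_one θ _).le
    · simp [t, h]
  have t_mem : ∀ g x, (t g x).re = 1 → x * g * x⁻¹ ∈ kerIn θ := by
    intro g x hx
    by_cases h : x * g * x⁻¹ ∈ A
    · simp only [t, h, dif_pos] at hx
      refine mem_kerIn.2 ⟨h, Units.ext ?_⟩
      have h2 := norm_apply_eq_one θ ⟨_, h⟩
      have h3 := Complex.re_eq_norm.1 (hx.trans h2.symm)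
      refine Complex.ext hx ?_
      simpa using (Complex.nonneg_iff.1 h3).2.symm
    · simp [t, h] at hx
  have hval : ∀ g, inducedChar θ g = (Nat.card A : ℂ)⁻¹ * ∑ x, t g x := fun g => rfl
  have hone : ∑ x, t 1 x = ∑ x : G, 1 :=
    Finset.sum_congr rfl fun x _ => t_eq 1 x (by simp)
  have hc : (Nat.card A : ℂ)⁻¹ ≠ 0 := inv_ne_zero (by exact_mod_cast Nat.card_pos.ne')
  change inducedChar θ g = inducedChar θ 1 ↔ _
  rw [hval, hval, mul_right_inj' hc, hone]
  refine ⟨fun h x => t_mem g x ?_, fun h => Finset.sum_congr rfl fun x _ => t_eq g x (h x)⟩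
  have hre : ∑ x, (t g x).re = ∑ x : G, 1 := by
    have := congrArg Complex.re h
    simpa [Complex.re_sum] using this
  exact (Finset.sum_eq_sum_iff_of_le fun x _ => t_le g x).1 hre x (Finset.mem_univ x)

theorem inducedKer_eq_normalCore [Fintype G] {A : Subgroup G} (θ : A →* ℂˣ) :
    inducedKer θ = ((kerIn θ).normalCore : Set G) := by
  ext g
  rw [mem_inducedKer]
  rfl

/-- `v` lies above `u`: its character extends that of `u`. -/
def Extends (u v : LinearTriple G) : Prop :=
  ∃ h : u.A ≤ v.A, v.θ.comp (Subgroup.inclusion h) = u.θ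

theorem Extends.refl (u : LinearTriple G) : Extends u u := ⟨le_rfl, rfl⟩

theorem Extends.trans {u v w : LinearTriple G} (h : Extends u v) (k : Extends v w) :
    Extends u w := by
  obtain ⟨h1, e1⟩ := h
  obtain ⟨h2, e2⟩ := k
  refine ⟨h1.trans h2, ?_⟩
  rw [← e1, ← e2]
  rfl

theorem kerIn_mono {A B : Subgroup G} {θ : A →* ℂˣ} {φ : B →* ℂˣ} (h : A ≤ B)
    (e : φ.comp (Subgroup.inclusion h) = θ) : kerIn θ ≤ kerIn φ := by
  intro g hg
  obtain ⟨hA, h1⟩ := mem_kerIn.1 hg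
  refine mem_kerIn.2 ⟨h hA, ?_⟩
  rw [← h1, ← e]
  rfl

theorem normalIn_kerIn (u : LinearTriple G) : NormalIn (kerIn u.θ) u.H := (isAbelianOver_kerIn u).1

theorem normal_subgroupOf_of_normalIn {K H : Subgroup G} (h : NormalIn K H) :
    (K.subgroupOf H).Normal :=
  ⟨fun n hn g => h.2 g g.2 n hn⟩

instance (u : LinearTriple G) : ((kerIn u.θ).subgroupOf u.H).Normal :=
  normal_subgroupOf_of_normalIn (normalIn_kerIn u)

/-- The quotient `H / ker θ`. -/
abbrev LinearTriple.Quot (u : LinearTriple G) : Type _ := u.H ⧸ (kerIn u.θ).subgroupOf u.H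

/-- The preimage in `H` of a subgroup of `H / ker θ`, as a subgroup of the whole group. -/
def LinearTriple.pullback (u : LinearTriple G) (C : Subgroup u.Quot) : Subgroup G :=
  (C.comap (QuotientGroup.mk' _)).map u.H.subtype

theorem LinearTriple.mem_pullback (u : LinearTriple G) {C : Subgroup u.Quot} {g : G} :
    g ∈ u.pullback C ↔ ∃ h : g ∈ u.H, ((⟨g, h⟩ : u.H) : u.Quot) ∈ C := by
  simp [LinearTriple.pullback, Subgroup.mem_map]

theorem LinearTriple.mk_commute_iff (u : LinearTriple G) (x y : u.H) :
    (x : u.Quot) * y = y * x ↔ ⁅(x : G), (y : G)⁆ ∈ kerIn u.θ := by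
  rw [← commutatorElement_eq_one_iff_mul_comm]
  change ((⁅x, y⁆ : u.H) : u.Quot) = 1 ↔ _
  rw [QuotientGroup.eq_one_iff]
  rfl

theorem LinearTriple.isAbelianOver_pullback (u : LinearTriple G) (C : Subgroup u.Quot)
    (hC : C.Normal) (hcomm : ∀ x ∈ C, ∀ y ∈ C, x * y = y * x) :
    IsAbelianOver u (u.pullback C) := by
  refine ⟨⟨fun g hg => (u.mem_pullback.1 hg).1, fun h hh b hb => ?_⟩, fun g hg => ?_, ?_⟩
  · obtain ⟨hb, hbC⟩ := u.mem_pullback.1 hb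
    exact u.mem_pullback.2 ⟨u.H.mul_mem (u.H.mul_mem hh hb) (u.H.inv_mem hh),
      hC.conj_mem _ hbC ((⟨h, hh⟩ : u.H) : u.Quot)⟩
  · have hH := (normalIn_kerIn u).1 hg
    refine u.mem_pullback.2 ⟨hH, ?_⟩
    rw [(QuotientGroup.eq_one_iff _).2 (show (⟨g, hH⟩ : u.H) ∈ (kerIn u.θ).subgroupOf u.H from hg)]
    exact C.one_mem
  · refine Subgroup.commutator_le.2 fun a ha b hb => ?_
    obtain ⟨ha, haC⟩ := u.mem_pullback.1 ha
    obtain ⟨hb, hbC⟩ := u.mem_pullback.1 hb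
    exact (u.mk_commute_iff ⟨a, ha⟩ ⟨b, hb⟩).1 (hcomm _ haC _ hbC)

/-- Invariance of `θ` means exactly that `θ` is trivial on the commutators `[h, a]`. -/
theorem LinearTriple.mk_mem_center (u : LinearTriple G) (a : G) (ha : a ∈ u.A) :
    ((⟨a, u.normal.1 ha⟩ : u.H) : u.Quot) ∈ Subgroup.center u.Quot := by
  rw [Subgroup.mem_center_iff]
  intro q
  obtain ⟨h, rfl⟩ := QuotientGroup.mk_surjective q
  rw [u.mk_commute_iff]
  have hc := u.normal.2 h h.2 a ha
  refine mem_kerIn.2 ⟨u.A.mul_mem hc (u.A.inv_mem ha), ?_⟩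
  have : (⟨⁅(h : G), a⁆, u.A.mul_mem hc (u.A.inv_mem ha)⟩ : u.A) = ⟨_, hc⟩ * ⟨a, ha⟩⁻¹ := rfl
  change u.θ ⟨⁅(h : G), a⁆, u.A.mul_mem hc (u.A.inv_mem ha)⟩ = 1
  rw [this, map_mul, u.invariant h h.2 ⟨a, ha⟩ ⟨_, hc⟩ rfl, map_inv, mul_inv_cancel]

theorem eq_of_isMaxAbelianOver [Finite G] {u : LinearTriple G} {B C : Subgroup G}
    (hB : IsMaxAbelianOver u B) (hC : IsAbelianOver u C) (h : B ≤ C) : B = C :=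
  Subgroup.eq_of_le_of_card_ge h (hB.2 C hC)

/-- Joining the centre of `H / ker θ` to an abelian normal subgroup of it. -/
theorem LinearTriple.isAbelianOver_pullback_sup_center (u : LinearTriple G) (C : Subgroup u.Quot)
    (hC : C.Normal) (hcomm : ∀ x ∈ C, ∀ y ∈ C, x * y = y * x) :
    IsAbelianOver u (u.pullback (C ⊔ Subgroup.center u.Quot)) := by
  refine u.isAbelianOver_pullback _ inferInstance fun x hx y hy => ?_
  obtain ⟨c, hc, z, hz, rfl⟩ := Subgroup.mem_sup_of_normal_right.1 hx
  obtain ⟨d, hd, w, hw, rfl⟩ := Subgroup.mem_sup_of_normal_right.1 hy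
  have h1 := Subgroup.mem_center_iff.1 hz
  have h2 := Subgroup.mem_center_iff.1 hw
  have hcd : Commute c d := hcomm c hc d hd
  have hz' : ∀ q, Commute z q := fun q => (h1 q).symm
  have hw' : ∀ q, Commute q w := fun q => h2 q
  exact ((hcd.mul_right (hw' c)).mul_left ((hz' d).mul_right (hz' w)))

/-- The image of `B` joined with the centre of `H / ker θ` is still abelian and normal, so by
maximality it is no larger; the centre contains the image of `A`. -/
theorem LinearTriple.le_of_isMaxAbelianOver [Finite G] {u : LinearTriple G} {B : Subgroup G}
    (hB : IsMaxAbelianOver u B) : u.A ≤ B := by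
  let C : Subgroup u.Quot := (B.subgroupOf u.H).map (QuotientGroup.mk' _)
  have hn : (B.subgroupOf u.H).Normal := normal_subgroupOf_of_normalIn hB.1.1
  have hC : C.Normal := hn.map _ (QuotientGroup.mk'_surjective _)
  have hcomm : ∀ x ∈ C, ∀ y ∈ C, x * y = y * x := by
    rintro _ ⟨x, hx, rfl⟩ _ ⟨y, hy, rfl⟩
    exact (u.mk_commute_iff x y).2 (hB.1.2.2 (Subgroup.commutator_mem_commutator hx hy))
  rw [eq_of_isMaxAbelianOver hB (u.isAbelianOver_pullback_sup_center C hC hcomm)]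
  · intro a ha
    exact u.mem_pullback.2 ⟨u.normal.1 ha, Subgroup.mem_sup_right (u.mk_mem_center a ha)⟩
  · intro b hb
    refine u.mem_pullback.2 ⟨hB.1.1.1 hb, Subgroup.mem_sup_left ⟨_, ?_, rfl⟩⟩
    exact hb

/-- If `A` were maximal, every abelian normal subgroup of `H / ker θ` would lie in the image of `A`,
hence be central. The class then leaves only the case of abelian `H / ker θ`, where `H` itself
competes and `H = A`. -/
theorem LinearTriple.lt_of_isMaxAbelianOver [Finite G] (hG : ClassC G) {u : LinearTriple G}
    {B : Subgroup G} (hB : IsMaxAbelianOver u B) (hu : u.H ≠ u.A) : u.A < B := by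
  refine lt_of_le_of_ne (le_of_isMaxAbelianOver hB) fun e => ?_
  subst e
  rcases hG u.H ((kerIn u.θ).subgroupOf u.H) with h | ⟨C, hC, hcomm, hnc⟩
  · refine hu (le_antisymm ?_ u.normal.1)
    have h1 := u.isAbelianOver_pullback ⊤ inferInstance fun x _ y _ => h x y
    have h2 : u.H ≤ u.pullback ⊤ := fun g hg => u.mem_pullback.2 ⟨hg, trivial⟩
    rwa [← eq_of_isMaxAbelianOver hB h1 (u.normal.1.trans h2)] at h2
  · refine hnc fun q hq => ?_
    obtain ⟨x, rfl⟩ := QuotientGroup.mk_surjective q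
    have h1 := eq_of_isMaxAbelianOver hB (u.isAbelianOver_pullback_sup_center C hC hcomm)
      fun a ha => u.mem_pullback.2 ⟨u.normal.1 ha, Subgroup.mem_sup_right (u.mk_mem_center a ha)⟩
    refine u.mk_mem_center x ?_
    rw [h1]
    exact u.mem_pullback.2 ⟨x.2, Subgroup.mem_sup_left hq⟩

/-- For `b = g a g⁻¹` the commutator `b⁻¹ g⁻¹ b g` equals `b⁻¹ a`. This links Shoda's condition to
the stabilizer; `g` need not normalize `H`. -/
theorem apply_conj_eq_of_commutator_mem {H : Subgroup G} {θ : H →* ℂˣ} {g : G}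
    (hg : ∀ h ∈ H, h⁻¹ * g⁻¹ * h * g ∈ H → h⁻¹ * g⁻¹ * h * g ∈ kerIn θ) :
    Fixes g θ := by
  intro a b hb
  have e : (b : G)⁻¹ * g⁻¹ * b * g = (b : G)⁻¹ * a := by rw [hb]; group
  obtain ⟨h1, h2⟩ := mem_kerIn.1 (hg b b.2 (by rw [e]; exact H.mul_mem (H.inv_mem b.2) a.2))
  have : (⟨_, h1⟩ : H) = b⁻¹ * a := Subtype.ext e
  rw [this, map_mul, map_inv, inv_mul_eq_one] at h2
  exact h2

theorem isShodaPair_kerIn [Finite G] {H : Subgroup G} (θ : H →* ℂˣ)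
    (h : ∀ g, Fixes g θ → g ∈ H) :
    IsShodaPair H (kerIn θ) := by
  have e : (kerIn θ).subgroupOf H = θ.ker := by
    ext x
    exact mem_kerIn.trans ⟨fun h => h.2, fun h => ⟨x.2, h⟩⟩
  refine ⟨kerIn_le θ, ⟨?_, ?_⟩, fun g hg => h g (apply_conj_eq_of_commutator_mem hg)⟩
  · rw [e]; infer_instance
  · have hn : ((kerIn θ).subgroupOf H).Normal := by rw [e]; infer_instance
    let f : H ⧸ (kerIn θ).subgroupOf H →* ℂˣ := QuotientGroup.lift _ θ (by rw [e])
    have hf : Function.Injective f := by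
      refine (injective_iff_map_eq_one f).2 fun q hq => ?_
      obtain ⟨x, rfl⟩ := QuotientGroup.mk_surjective q
      refine (QuotientGroup.eq_one_iff x).2 ?_
      rw [e]
      exact hq
    exact isCyclic_of_injective_ringHom ((Units.coeHom ℂ).comp f) (Units.val_injective.comp hf)

/-! ### Paths of Clifford correspondents: unique parents, and Shoda pairs at leaves -/

variable [Fintype G] {c : CliffordChoice G}

theorem CliffordChoice.extends_of_mem_Cl {u v : LinearTriple G} (h : v ∈ c.Cl u) : Extends u v := by
  obtain ⟨-, φ, hφ, rfl⟩ := h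
  exact (c.reps_subset u hφ).1

theorem CliffordChoice.lt_of_mem_Cl (hG : ClassC G) {u v : LinearTriple G} (h : v ∈ c.Cl u) :
    u.A < v.A := by
  obtain ⟨hu, φ, hφ, rfl⟩ := h
  exact LinearTriple.lt_of_isMaxAbelianOver hG (c.sub_spec u) hu

/-- Both characters are the restriction of `x.θ` to the same subgroup `c.sub u`, and the character
determines the whole correspondent. -/
theorem CliffordChoice.eq_of_mem_Cl_of_extends {u v w x : LinearTriple G} (hv : v ∈ c.Cl u)
    (hw : w ∈ c.Cl u) (hvx : Extends v x) (hwx : Extends w x) : v = w := by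
  obtain ⟨-, φ, -, rfl⟩ := hv
  obtain ⟨-, ψ, -, rfl⟩ := hw
  obtain ⟨h1, e1⟩ := hvx
  obtain ⟨h2, e2⟩ := hwx
  have e : φ = ψ := e1.symm.trans e2
  subst e
  rfl

variable {N : Subgroup G}

theorem extends_of_reflTransGen {u v : {u : LinearTriple G // u.IsNLinear N}}
    (h : Relation.ReflTransGen (tripleDigraph c N).Adj u v) : Extends u.1 v.1 := by
  induction h with
  | refl => exact Extends.refl _
  | tail _ hb ih => exact ih.trans (c.extends_of_mem_Cl hb)

theorem comparable_of_reflTransGen {r x y v : {u : LinearTriple G // u.IsNLinear N}}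
    (hx : Relation.ReflTransGen (tripleDigraph c N).Adj r x)
    (hy : Relation.ReflTransGen (tripleDigraph c N).Adj r y)
    (hxv : Relation.ReflTransGen (tripleDigraph c N).Adj x v)
    (hyv : Relation.ReflTransGen (tripleDigraph c N).Adj y v) :
    Relation.ReflTransGen (tripleDigraph c N).Adj x y ∨
      Relation.ReflTransGen (tripleDigraph c N).Adj y x := by
  induction hx with
  | refl => exact Or.inl hy
  | @tail x' x _ hb ih =>
    rcases ih (hxv.head hb) with h | h
    · rcases h.cases_head with e | ⟨z, hz, hzy⟩
      · subst e
        exact Or.inr (Relation.ReflTransGen.single hb)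
      · have : x = z := Subtype.ext (c.eq_of_mem_Cl_of_extends hb hz
          (extends_of_reflTransGen hxv) (extends_of_reflTransGen (hzy.trans hyv)))
        subst this
        exact Or.inl hzy
    · exact Or.inr (h.tail hb)

theorem card_lt_of_adj (hG : ClassC G) (u v : {u : LinearTriple G // u.IsNLinear N})
    (h : (tripleDigraph c N).Adj u v) : Nat.card u.1.A < Nat.card v.1.A := by
  have h' : v.1 ∈ c.Cl u.1 := h
  have := c.lt_of_mem_Cl hG h'
  exact Set.ncard_lt_ncard (SetLike.coe_ssubset_coe.2 this)

theorem parent_unique (hG : ClassC G) {r x y v : {u : LinearTriple G // u.IsNLinear N}}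
    (hx : Relation.ReflTransGen (tripleDigraph c N).Adj r x)
    (hy : Relation.ReflTransGen (tripleDigraph c N).Adj r y)
    (hxv : (tripleDigraph c N).Adj x v) (hyv : (tripleDigraph c N).Adj y v) : x = y := by
  have key : ∀ {x y : {u : LinearTriple G // u.IsNLinear N}},
      (tripleDigraph c N).Adj x v → (tripleDigraph c N).Adj y v →
      Relation.ReflTransGen (tripleDigraph c N).Adj x y → x = y := by
    intro x y hxv hyv h
    rcases h.cases_head with e | ⟨z, hz, hzy⟩
    · exact e
    -- The path from `x` to `y` starts with a sibling of `v` that `v` extends, hence with `v`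
    -- itself; then `v` would reach its own parent `y`, against the rank.
    · have : v = z := Subtype.ext (c.eq_of_mem_Cl_of_extends hxv hz (Extends.refl _)
        (extends_of_reflTransGen (hzy.tail hyv)))
      subst this
      exact absurd (rank_le_of_reflTransGen (card_lt_of_adj hG) hzy)
        (card_lt_of_adj hG _ _ hyv).not_ge
  rcases comparable_of_reflTransGen hx hy (Relation.ReflTransGen.single hxv)
    (Relation.ReflTransGen.single hyv) with h | h
  · exact key hxv hyv h
  · exact (key hyv hxv h).symm

theorem treeDigraph_reachable [N.Normal] (v : TreeVertex c N) :
    Relation.ReflTransGen (treeDigraph c N).Adj (treeRoot c N) v := by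
  obtain ⟨_, hv⟩ := v
  induction hv with
  | refl => exact Relation.ReflTransGen.refl
  | tail _ hb ih => exact ih.tail hb

theorem isRootedDirectedTree_treeDigraph (hG : ClassC G) (c : CliffordChoice G)
    (N : Subgroup G) [N.Normal] :
    IsRootedDirectedTree (treeDigraph c N) (treeRoot c N) :=
  isRootedDirectedTree_of_rank (fun v => Nat.card v.1.1.A)
    (fun _ _ h => card_lt_of_adj hG _ _ h)
    (fun u u' _ h h' => Subtype.ext (parent_unique hG u.2 u'.2 h h'))
    treeDigraph_reachable

/-- An element fixing the last character fixes its restrictions, so it survives each passage to an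
inertia group, starting from `⊤` at the root. -/
theorem mem_H_of_fixes [N.Normal] {w v : {u : LinearTriple G // u.IsNLinear N}}
    (hw : Relation.ReflTransGen (tripleDigraph c N).Adj (rootVertex N) w)
    (hwv : Relation.ReflTransGen (tripleDigraph c N).Adj w v) {g : G} (hg : Fixes g v.1.θ) :
    g ∈ w.1.H := by
  induction hw with
  | refl => exact Subgroup.mem_top g
  | @tail u w _ hb ih =>
    have hu := ih (hwv.head hb)
    obtain ⟨h, e⟩ := extends_of_reflTransGen hwv
    have hfix : Fixes g w.1.θ := by
      intro a b hab
      rw [← e]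
      exact hg _ _ hab
    obtain ⟨w, hwN⟩ := w
    obtain ⟨-, φ, -, rfl⟩ := (show w ∈ c.Cl u.1 from hb)
    exact ⟨hu, hfix⟩

theorem isShodaPair_of_reachable [N.Normal] {v : {u : LinearTriple G // u.IsNLinear N}}
    (hv : Relation.ReflTransGen (tripleDigraph c N).Adj (rootVertex N) v)
    (hvA : v.1.H = v.1.A) : IsShodaPair v.1.H (kerIn v.1.θ) := by
  have h := isShodaPair_kerIn v.1.θ fun g hg =>
    hvA ▸ mem_H_of_fixes hv Relation.ReflTransGen.refl hg
  rw [hvA]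
  exact h

end Group

/-! ### Idempotents of linear characters in the complex group algebra -/

section Algebra

set_option linter.unusedSectionVars false

open Classical

variable {G : Type*} [Group G] [Fintype G]

open MonoidAlgebra (of)

/-- The idempotent of `ℂG` afforded by a linear character of a subgroup. -/
def charIdem {A : Subgroup G} (θ : A →* ℂˣ) : MonoidAlgebra ℂ G :=
  (Nat.card A : ℂ)⁻¹ • ∑ a : A, ((θ a⁻¹ : ℂˣ) : ℂ) • of ℂ G a

theorem of_mul_charIdem {A : Subgroup G} (θ : A →* ℂˣ) (b : A) :
    of ℂ G b * charIdem θ = ((θ b : ℂˣ) : ℂ) • charIdem θ := by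
  have key : of ℂ G (b : G) * (∑ a : A, ((θ a⁻¹ : ℂˣ) : ℂ) • of ℂ G (a : G)) =
      ((θ b : ℂˣ) : ℂ) • ∑ a : A, ((θ a⁻¹ : ℂˣ) : ℂ) • of ℂ G (a : G) := by
    rw [Finset.mul_sum, Finset.smul_sum]
    refine Fintype.sum_equiv (Equiv.mulLeft b) _ _ fun a => ?_
    rw [mul_smul_comm, ← map_mul (of ℂ G), smul_smul, ← Units.val_mul, Equiv.coe_mulLeft, mul_inv_rev,
      map_mul θ, map_inv θ b, mul_left_comm, mul_inv_cancel, mul_one, Subgroup.coe_mul]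
  rw [charIdem, mul_smul_comm, key, smul_comm]

theorem charIdem_mul_of {A : Subgroup G} (θ : A →* ℂˣ) (b : A) :
    charIdem θ * of ℂ G b = ((θ b : ℂˣ) : ℂ) • charIdem θ := by
  have key : (∑ a : A, ((θ a⁻¹ : ℂˣ) : ℂ) • of ℂ G (a : G)) * of ℂ G (b : G) =
      ((θ b : ℂˣ) : ℂ) • ∑ a : A, ((θ a⁻¹ : ℂˣ) : ℂ) • of ℂ G (a : G) := by
    rw [Finset.sum_mul, Finset.smul_sum]
    refine Fintype.sum_equiv (Equiv.mulRight b) _ _ fun a => ?_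
    rw [smul_mul_assoc, ← map_mul (of ℂ G), smul_smul, ← Units.val_mul, Equiv.coe_mulRight, mul_inv_rev,
      map_mul θ, map_inv θ b, mul_inv_cancel_left, Subgroup.coe_mul]
  rw [charIdem, smul_mul_assoc, key, smul_comm]

theorem coeff_charIdem {A : Subgroup G} (θ : A →* ℂˣ) (g : G) :
    (charIdem θ).coeff g =
      if h : g ∈ A then (Nat.card A : ℂ)⁻¹ * ((θ ⟨g, h⟩⁻¹ : ℂˣ) : ℂ) else 0 := by
  unfold charIdem
  rw [MonoidAlgebra.coeff_smul_apply, MonoidAlgebra.coeff_sum, Finsupp.finsetSum_apply]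
  simp only [MonoidAlgebra.coeff_smul_apply, MonoidAlgebra.of_apply,
    MonoidAlgebra.coeff_single, Finsupp.single_apply, smul_eq_mul]
  split_ifs with h
  · rw [Finset.sum_eq_single ⟨g, h⟩]
    · simp
    · intro b _ hb
      rw [if_neg fun e => hb (Subtype.ext e), mul_zero]
    · simp
  · rw [Finset.sum_eq_zero, mul_zero]
    intro b _
    rw [if_neg, mul_zero]
    rintro rfl
    exact h b.2

theorem charIdem_ne_zero {A : Subgroup G} (θ : A →* ℂˣ) : charIdem θ ≠ 0 := by
  intro h
  have h1 := coeff_charIdem θ 1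
  rw [h, dif_pos A.one_mem] at h1
  have : (Nat.card A : ℂ)⁻¹ ≠ 0 := inv_ne_zero (by exact_mod_cast Nat.card_pos.ne')
  exact mul_ne_zero this (Units.ne_zero _) h1.symm

/-- Comparing coefficients at `g` puts `g` in the support `A`; then `g` acts by the scalar `θ g`. -/
theorem mem_kerIn_of_of_mul_charIdem {A : Subgroup G} {θ : A →* ℂˣ} {g : G}
    (h : of ℂ G g * charIdem θ = charIdem θ) : g ∈ kerIn θ := by
  have hc : (Nat.card A : ℂ)⁻¹ ≠ 0 := inv_ne_zero (by exact_mod_cast Nat.card_pos.ne')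
  have hA : g ∈ A := by
    have h1 := congrArg (fun x => x.coeff g) h
    simp only [MonoidAlgebra.of_apply, MonoidAlgebra.coeff_single_mul_apply, one_mul,
      inv_mul_cancel] at h1
    by_contra hg
    rw [coeff_charIdem, coeff_charIdem, dif_pos A.one_mem, dif_neg hg] at h1
    exact mul_ne_zero hc (Units.ne_zero _) h1
  refine mem_kerIn.2 ⟨hA, Units.ext ?_⟩
  have h2 := of_mul_charIdem θ ⟨g, hA⟩
  rw [h] at h2
  have h3 : (((θ ⟨g, hA⟩ : ℂˣ) : ℂ) - 1) • charIdem θ = 0 := by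
    rw [sub_smul, ← h2, one_smul, sub_self]
  rcases smul_eq_zero.1 h3 with h4 | h4
  · exact sub_eq_zero.1 h4
  · exact absurd h4 (charIdem_ne_zero θ)

theorem sum_apply_inv_mul {A : Subgroup G} (θ χ : A →* ℂˣ) :
    (Nat.card A : ℂ)⁻¹ * ∑ a : A, ((θ a⁻¹ : ℂˣ) : ℂ) * ((χ a : ℂˣ) : ℂ) =
      if χ = θ then 1 else 0 := by
  have h := sum_hom_units ((Units.coeHom ℂ).comp (χ * θ⁻¹))
  have e : ∀ a, ((Units.coeHom ℂ).comp (χ * θ⁻¹)) a =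
      ((θ a⁻¹ : ℂˣ) : ℂ) * ((χ a : ℂˣ) : ℂ) := by
    intro a
    simp [mul_comm]
  simp only [e] at h
  rw [h]
  have e2 : (Units.coeHom ℂ).comp (χ * θ⁻¹) = 1 ↔ χ = θ := by
    constructor
    · intro h
      ext a
      have h1 := DFunLike.congr_fun h a
      rw [e] at h1
      rw [map_inv, Units.val_inv_eq_inv_val] at h1
      have := (inv_mul_eq_one₀ (Units.ne_zero _)).1 h1
      exact this.symm
    · rintro rfl
      ext a
      simp
  have hc : (Nat.card A : ℂ) ≠ 0 := by exact_mod_cast Nat.card_pos.ne'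
  by_cases hχ : χ = θ
  · rw [if_pos (e2.2 hχ), if_pos hχ, ← Nat.card_eq_fintype_card, inv_mul_cancel₀ hc]
  · rw [if_neg (mt e2.1 hχ), if_neg hχ, Nat.cast_zero, mul_zero]

theorem charIdem_mul_charIdem {A B : Subgroup G} (θ : A →* ℂˣ) (φ : B →* ℂˣ) (h : A ≤ B) :
    charIdem θ * charIdem φ = if φ.comp (Subgroup.inclusion h) = θ then charIdem φ else 0 := by
  have e : charIdem θ * charIdem φ = ((Nat.card A : ℂ)⁻¹ *
      ∑ a : A, ((θ a⁻¹ : ℂˣ) : ℂ) * ((φ.comp (Subgroup.inclusion h) a : ℂˣ) : ℂ)) •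
        charIdem φ := by
    rw [charIdem.eq_1 θ, smul_mul_assoc, Finset.sum_mul, mul_smul, Finset.sum_smul]
    congr 1
    refine Finset.sum_congr rfl fun a _ => ?_
    rw [smul_mul_assoc, mul_smul]
    congr 1
    exact of_mul_charIdem φ (Subgroup.inclusion h a)
  rw [e, sum_apply_inv_mul]
  split_ifs <;> simp

theorem charIdem_mul_charIdem' {A B : Subgroup G} (θ : A →* ℂˣ) (φ : B →* ℂˣ) (h : A ≤ B) :
    charIdem φ * charIdem θ = if φ.comp (Subgroup.inclusion h) = θ then charIdem φ else 0 := by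
  have e : charIdem φ * charIdem θ = ((Nat.card A : ℂ)⁻¹ *
      ∑ a : A, ((θ a⁻¹ : ℂˣ) : ℂ) * ((φ.comp (Subgroup.inclusion h) a : ℂˣ) : ℂ)) •
        charIdem φ := by
    rw [charIdem.eq_1 θ, mul_smul_comm, Finset.mul_sum, mul_smul, Finset.sum_smul]
    congr 1
    refine Finset.sum_congr rfl fun a _ => ?_
    rw [mul_smul_comm, mul_smul]
    congr 1
    exact charIdem_mul_of φ (Subgroup.inclusion h a)
  rw [e, sum_apply_inv_mul]
  split_ifs <;> simp

theorem charIdem_mul_self {A : Subgroup G} (θ : A →* ℂˣ) :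
    charIdem θ * charIdem θ = charIdem θ := by
  rw [charIdem_mul_charIdem θ θ le_rfl, if_pos]
  rfl

theorem charIdem_mul_eq_zero {A : Subgroup G} {θ φ : A →* ℂˣ} (h : φ ≠ θ) :
    charIdem θ * charIdem φ = 0 := by
  rw [charIdem_mul_charIdem θ φ le_rfl, if_neg]
  exact h

theorem comp_inclusion_eq_one_iff {K B : Subgroup G} (h : K ≤ B) (φ : B →* ℂˣ) :
    φ.comp (Subgroup.inclusion h) = 1 ↔ K ≤ kerIn φ := by
  constructor
  · intro e g hg
    exact mem_kerIn.2 ⟨h hg, DFunLike.congr_fun e ⟨g, hg⟩⟩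
  · intro hK
    ext a
    obtain ⟨h1, h2⟩ := mem_kerIn.1 (hK a.2)
    exact congrArg Units.val h2

/-- Packages the quotient as an abstract commutative group, so that duality of finite abelian groups
applies to it. -/
theorem exists_commGroup_quotient {B : Type u} [Group B] (N : Subgroup B) [N.Normal]
    (h : ∀ x y : B, ⁅x, y⁆ ∈ N) :
    ∃ (Q : Type u) (_ : CommGroup Q) (π : B →* Q), Function.Surjective π ∧
      ∀ b, π b = 1 ↔ b ∈ N := by
  refine ⟨B ⧸ N, { (inferInstance : Group (B ⧸ N)) with mul_comm := ?_ }, QuotientGroup.mk' N,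
    QuotientGroup.mk'_surjective N, fun b => QuotientGroup.eq_one_iff b⟩
  intro x y
  obtain ⟨x, rfl⟩ := QuotientGroup.mk_surjective x
  obtain ⟨y, rfl⟩ := QuotientGroup.mk_surjective y
  refine commutatorElement_eq_one_iff_mul_comm.1 ?_
  change ((⁅x, y⁆ : B) : B ⧸ N) = 1
  exact (QuotientGroup.eq_one_iff _).2 (h x y)

/-- Evaluation at `q` is a character of the dual group, nontrivial when `q ≠ 1`. -/
theorem sum_dual_apply {Q : Type*} [CommGroup Q] [Finite Q] [Fintype (Q →* ℂˣ)] (q : Q) :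
    ∑ χ : Q →* ℂˣ, ((χ q : ℂˣ) : ℂ) = if q = 1 then (Nat.card Q : ℂ) else 0 := by
  split_ifs with hq
  · subst hq
    simp [← CommGroup.card_monoidHom_of_hasEnoughRootsOfUnity Q ℂ]
  · let ev : (Q →* ℂˣ) →* ℂ := (Units.coeHom ℂ).comp (MonoidHom.eval q)
    refine sum_hom_units_eq_zero ev fun h => ?_
    obtain ⟨χ, hχ⟩ := CommGroup.exists_apply_ne_one_of_hasEnoughRootsOfUnity Q ℂ hq
    exact hχ (Units.ext (DFunLike.congr_fun h χ))

/-- If `B / K` is abelian, then the idempotent of the trivial character of `K` is the sum of those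
of the linear characters of `B` that are trivial on `K`. -/
theorem charIdem_one_eq_sum {K B : Subgroup G} (hKB : K ≤ B) (hB : ⁅B, B⁆ ≤ K) :
    ∃ S : Finset (B →* ℂˣ), (∀ φ ∈ S, K ≤ kerIn φ) ∧
      charIdem (1 : K →* ℂˣ) = ∑ φ ∈ S, charIdem φ := by
  have hn : (K.subgroupOf B).Normal := ⟨fun n hn g => by
    have h1 : ⁅(g : G), (n : G)⁆ ∈ K := hB (Subgroup.commutator_mem_commutator g.2 n.2)
    have h2 := K.mul_mem h1 hn
    rw [commutatorElement_def] at h2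
    have h3 : ((g * n * g⁻¹ : B) : G) = g * n * (g : G)⁻¹ * (n : G)⁻¹ * n := by simp
    change ((g * n * g⁻¹ : B) : G) ∈ K
    rw [h3]
    exact h2⟩
  obtain ⟨Q, _, π, hsurj, hπ⟩ := exists_commGroup_quotient (K.subgroupOf B)
    fun x y => hB (Subgroup.commutator_mem_commutator x.2 y.2)
  have : Finite Q := Finite.of_surjective π hsurj
  let _ : Fintype (Q →* ℂˣ) := Fintype.ofFinite _
  let f : (Q →* ℂˣ) ↪ (B →* ℂˣ) :=
    ⟨fun χ => χ.comp π, fun χ ψ h => by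
      ext q
      obtain ⟨b, rfl⟩ := hsurj q
      exact congrArg Units.val (DFunLike.congr_fun h b)⟩
  refine ⟨Finset.univ.map f, ?_, ?_⟩
  · intro φ hφ
    obtain ⟨χ, -, rfl⟩ := Finset.mem_map.1 hφ
    intro g hg
    refine mem_kerIn.2 ⟨hKB hg, ?_⟩
    change χ (π ⟨g, hKB hg⟩) = 1
    rw [(hπ ⟨g, hKB hg⟩).2 hg, map_one]
  · apply MonoidAlgebra.ext
    ext g
    rw [Finset.sum_map, MonoidAlgebra.coeff_sum, Finsupp.finsetSum_apply]
    simp only [coeff_charIdem]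
    by_cases hgB : g ∈ B
    · simp only [dif_pos hgB, ← Finset.mul_sum]
      have h1 := sum_dual_apply (π ⟨g, hgB⟩⁻¹)
      have h2 : (∑ χ : Q →* ℂˣ, ((f χ ⟨g, hgB⟩⁻¹ : ℂˣ) : ℂ)) =
        ∑ χ : Q →* ℂˣ, ((χ (π ⟨g, hgB⟩⁻¹) : ℂˣ) : ℂ) := rfl
      rw [h2, h1]
      have h3 : π ⟨g, hgB⟩⁻¹ = 1 ↔ g ∈ K := by rw [map_inv, inv_eq_one]; exact hπ _
      have hcard : (Nat.card B : ℂ) = Nat.card Q * Nat.card K := by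
        have hk : π.ker = K.subgroupOf B := by ext b; exact hπ b
        have := π.ker.card_eq_card_quotient_mul_card_subgroup
        rw [Nat.card_congr (QuotientGroup.quotientKerEquivOfSurjective π hsurj).toEquiv, hk,
          Nat.card_congr (Subgroup.subgroupOfEquivOfLe hKB).toEquiv] at this
        exact_mod_cast this
      have hcQ : (Nat.card Q : ℂ) ≠ 0 := by exact_mod_cast Nat.card_pos.ne'
      by_cases hgK : g ∈ K
      · rw [dif_pos hgK, if_pos (h3.2 hgK), hcard]
        simp [hcQ]
      · rw [dif_neg hgK, if_neg (mt h3.1 hgK), mul_zero]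
    · have hgK : g ∉ K := fun h => hgB (hKB h)
      simp [hgB, hgK]

/-- Multiplying the decomposition of the idempotent of `ker θ` by `e_θ` keeps only the characters
extending `θ`, so `e_θ` is a sum of such `e_φ`. -/
theorem exists_extension_mul_ne_zero {A B : Subgroup G} {θ : A →* ℂˣ} (hAB : A ≤ B)
    (hB : ⁅B, B⁆ ≤ kerIn θ) {X : MonoidAlgebra ℂ G} (hX : X * charIdem θ ≠ 0) :
    ∃ φ : B →* ℂˣ, φ.comp (Subgroup.inclusion hAB) = θ ∧ X * charIdem φ ≠ 0 := by
  obtain ⟨S, -, hS⟩ := charIdem_one_eq_sum ((kerIn_le θ).trans hAB) hB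
  have h1 : charIdem (1 : kerIn θ →* ℂˣ) * charIdem θ = charIdem θ := by
    rw [charIdem_mul_charIdem _ _ (kerIn_le θ), if_pos]
    exact (comp_inclusion_eq_one_iff _ _).2 le_rfl
  rw [← h1, hS, Finset.sum_mul, Finset.mul_sum] at hX
  obtain ⟨φ, -, hφ⟩ := Finset.exists_ne_zero_of_sum_ne_zero hX
  rw [charIdem_mul_charIdem' θ φ hAB] at hφ
  by_cases h : φ.comp (Subgroup.inclusion hAB) = θ
  · exact ⟨φ, h, by rwa [if_pos h] at hφ⟩
  · simp [h] at hφ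

/-- The embedding of `ℚG` into `ℂG`. -/
def complexify : MonoidAlgebra ℚ G →+* MonoidAlgebra ℂ G :=
  MonoidAlgebra.mapRingHom G (algebraMap ℚ ℂ)

theorem complexify_injective : Function.Injective (complexify (G := G)) :=
  MonoidAlgebra.map_injective (algebraMap ℚ ℂ).toAddMonoidHom (algebraMap ℚ ℂ).injective

theorem complexify_of (g : G) : complexify (of ℚ G g) = of ℂ G g := by
  simp [complexify, MonoidAlgebra.of_apply, MonoidAlgebra.mapRingHom_single]

theorem complexify_smul (q : ℚ) (x : MonoidAlgebra ℚ G) :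
    complexify (q • x) = (q : ℂ) • complexify x := by
  apply MonoidAlgebra.ext
  ext g
  simp [complexify, MonoidAlgebra.coeff_mapRingHom]

theorem complexify_hat (H : Subgroup G) : complexify (hat H) = charIdem (1 : H →* ℂˣ) := by
  unfold hat charIdem
  rw [complexify_smul, map_sum]
  simp only [complexify_of, MonoidHom.one_apply, Units.val_one, one_smul]
  push_cast
  congr 1
  exact Finset.sum_subtype _ (by simp) _

theorem hat_mul_charIdem {L H : Subgroup G} (h : L ≤ H) (μ : H →* ℂˣ) :
    complexify (hat L) * charIdem μ = if L ≤ kerIn μ then charIdem μ else 0 := by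
  rw [complexify_hat, charIdem_mul_charIdem _ _ h]
  simp only [comp_inclusion_eq_one_iff]

theorem hat_mul_hat {K L : Subgroup G} (h : K ≤ L) : hat L * hat K = hat L := by
  apply complexify_injective
  rw [map_mul, complexify_hat, complexify_hat, charIdem_mul_charIdem' _ _ h, if_pos]
  rfl

theorem normalIn_kerIn_self {H : Subgroup G} (μ : H →* ℂˣ) : NormalIn (kerIn μ) H := by
  refine ⟨kerIn_le μ, fun h hh b hb => ?_⟩
  obtain ⟨h1, h2⟩ := mem_kerIn.1 hb
  refine mem_kerIn.2 ⟨H.mul_mem (H.mul_mem hh h1) (H.inv_mem hh), ?_⟩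
  rw [← h2]
  exact fixes_of_mem μ h hh ⟨b, h1⟩ _ rfl

/-- A factor `hat K - hat L` acts as 0 if `L ≤ ker μ` and as 1 otherwise. If `K < ker μ`, some
minimal `L` lies in `ker μ`, since `ker μ` is itself normal in `H`. -/
theorem eps_mul_charIdem {H K : Subgroup G} {μ : H →* ℂˣ} (hK : K ≤ kerIn μ) :
    complexify (eps H K) * charIdem μ = if kerIn μ = K then charIdem μ else 0 := by
  unfold eps
  have hKH : K ≤ H := hK.trans (kerIn_le μ)
  have factor : ∀ L, IsMinNormalOver H K L → complexify (hat K - hat L) * charIdem μ =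
      if L ≤ kerIn μ then 0 else charIdem μ := by
    intro L hL
    rw [map_sub, sub_mul, hat_mul_charIdem hKH, hat_mul_charIdem hL.1.1.1, if_pos hK]
    split_ifs <;> simp
  by_cases hHK : H = K
  · rw [if_pos hHK, hat_mul_charIdem hKH, if_pos hK, if_pos]
    exact le_antisymm ((kerIn_le μ).trans hHK.le) hK
  rw [if_neg hHK]
  by_cases hμ : kerIn μ = K
  · rw [if_pos hμ]
    refine Finset.noncommProd_induction _ _ _
      (fun x => complexify x * charIdem μ = charIdem μ) ?_ ?_ ?_
    · intro a b ha hb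
      rw [map_mul, mul_assoc, hb, ha]
    · rw [map_one, one_mul]
    · intro L hL
      have hL' : IsMinNormalOver H K L := by simpa using hL
      rw [factor L hL', if_neg]
      rw [hμ]
      exact hL'.1.2.not_ge
  · rw [if_neg hμ]
    obtain ⟨L, hLμ, hL⟩ := exists_minimal_le_of_wellFoundedLT
      (fun M : Subgroup G => NormalIn M H ∧ K < M) (kerIn μ)
      ⟨normalIn_kerIn_self μ, lt_of_le_of_ne hK (Ne.symm hμ)⟩
    have hmem : L ∈ Finset.univ.filter (IsMinNormalOver H K) :=
      Finset.mem_filter.2 ⟨Finset.mem_univ _, hL⟩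
    rw [← Finset.noncommProd_erase_mul _ hmem _ (eps_comm H K), map_mul, mul_assoc,
      factor L hL, if_pos hLμ, mul_zero]

theorem eps_mul_hat {H K : Subgroup G} (hKH : K ≤ H) : eps H K * hat K = eps H K := by
  unfold eps
  by_cases hHK : H = K
  · rw [if_pos hHK, hat_mul_hat le_rfl]
  · rw [if_neg hHK]
    obtain ⟨L, -, hL⟩ := exists_minimal_le_of_wellFoundedLT
      (fun M : Subgroup G => NormalIn M H ∧ K < M) H
      ⟨⟨le_rfl, fun h hh b hb => H.mul_mem (H.mul_mem hh hb) (H.inv_mem hh)⟩,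
        lt_of_le_of_ne hKH (Ne.symm hHK)⟩
    have hmem : L ∈ Finset.univ.filter (IsMinNormalOver H K) :=
      Finset.mem_filter.2 ⟨Finset.mem_univ _, hL⟩
    rw [← Finset.noncommProd_erase_mul _ hmem _ (eps_comm H K), mul_assoc, sub_mul,
      hat_mul_hat le_rfl, hat_mul_hat hL.1.2.le]

/-- `ε(H, K)` is the sum of the idempotents of the linear characters of `H` with kernel `K`. -/
theorem complexify_eps {H K : Subgroup G} (hKH : K ≤ H) (hH : ⁅H, H⁆ ≤ K) :
    ∃ S : Finset (H →* ℂˣ), (∀ φ ∈ S, kerIn φ = K) ∧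
      complexify (eps H K) = ∑ φ ∈ S, charIdem φ := by
  obtain ⟨S, hS, e⟩ := charIdem_one_eq_sum hKH hH
  refine ⟨S.filter fun φ => kerIn φ = K, fun φ hφ => (Finset.mem_filter.1 hφ).2, ?_⟩
  rw [← eps_mul_hat hKH, map_mul, complexify_hat, e, Finset.mul_sum, Finset.sum_filter]
  exact Finset.sum_congr rfl fun φ hφ => eps_mul_charIdem (hS φ hφ)

/-- For rational `X`, the vanishing of `X e_λ` depends only on the kernel of `λ`. -/
theorem mul_charIdem_eq_zero_of_kerIn_eq {H : Subgroup G} {l μ : H →* ℂˣ}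
    (h : kerIn l = kerIn μ) {X : MonoidAlgebra ℚ G} (hX : complexify X * charIdem l = 0) :
    complexify X * charIdem μ = 0 := by
  have hker : ∀ x : H, l x = 1 ↔ μ x = 1 := by
    intro x
    have h1 : (x : G) ∈ kerIn l ↔ (x : G) ∈ kerIn μ := by rw [h]
    simpa [mem_kerIn] using h1
  -- The image of `l` is cyclic, so all its values are powers of one `l x`. Equality of kernels
  -- makes the same exponents work for `μ`.
  obtain ⟨⟨_, x, rfl⟩, hx⟩ := IsCyclic.exists_generator (α := l.range)
  have hpow : ∀ t : H, ∃ i : ℕ, l t⁻¹ = l x ^ i := by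
    intro t
    obtain ⟨i, hi⟩ := ((isOfFinOrder_of_finite _).mem_powers_iff_mem_zpowers).2
      (hx ⟨l t⁻¹, t⁻¹, rfl⟩)
    exact ⟨i, (congrArg Subtype.val hi).symm⟩
  choose i hi using hpow
  have hi' : ∀ t, μ t⁻¹ = μ x ^ i t := by
    intro t
    have h1 : l (t⁻¹ * (x ^ i t)⁻¹) = 1 := by
      rw [map_mul, hi, map_inv, map_pow, mul_inv_cancel]
    rw [hker, map_mul, map_inv μ (x ^ i t), map_pow, mul_inv_eq_one] at h1
    exact h1
  have hord : orderOf (l x) = orderOf (μ x) := by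
    rw [orderOf_eq_orderOf_iff]
    intro n
    rw [← map_pow, ← map_pow, hker]
  have hpos : 0 < orderOf (l x) := (MonoidHom.isOfFinOrder l (isOfFinOrder_of_finite x)).orderOf_pos
  -- Both values are primitive roots of unity of the same order, hence roots of the same cyclotomic
  -- polynomial.
  have hmin : minpoly ℚ ((l x : ℂˣ) : ℂ) = minpoly ℚ ((μ x : ℂˣ) : ℂ) := by
    have p1 : IsPrimitiveRoot ((l x : ℂˣ) : ℂ) (orderOf (l x)) :=
      IsPrimitiveRoot.coe_units_iff.2 (IsPrimitiveRoot.orderOf _)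
    have p2 : IsPrimitiveRoot ((μ x : ℂˣ) : ℂ) (orderOf (l x)) := by
      rw [hord]
      exact IsPrimitiveRoot.coe_units_iff.2 (IsPrimitiveRoot.orderOf _)
    rw [← Polynomial.cyclotomic_eq_minpoly_rat p1 hpos,
      ← Polynomial.cyclotomic_eq_minpoly_rat p2 hpos]
  -- Up to the factor `1/|H|`, the coefficient at `g` of the product with the idempotent of `l` or
  -- `μ` is one rational polynomial evaluated at `l x` or `μ x`.
  let P : G → Polynomial ℚ := fun g =>
    ∑ t : H, Polynomial.C ((X * of ℚ G t).coeff g) * Polynomial.X ^ i t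
  have hcoef : ∀ (ν : H →* ℂˣ), (∀ t, ν t⁻¹ = ν x ^ i t) → ∀ g,
      (complexify X * charIdem ν).coeff g =
        (Nat.card H : ℂ)⁻¹ * Polynomial.aeval ((ν x : ℂˣ) : ℂ) (P g) := by
    intro ν hν g
    unfold charIdem
    rw [mul_smul_comm, Finset.mul_sum, MonoidAlgebra.coeff_smul_apply, MonoidAlgebra.coeff_sum,
      Finsupp.finsetSum_apply, smul_eq_mul, map_sum]
    congr 1
    refine Finset.sum_congr rfl fun t _ => ?_
    rw [mul_smul_comm, ← complexify_of, ← map_mul, MonoidAlgebra.coeff_smul_apply,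
      map_mul (Polynomial.aeval _), Polynomial.aeval_C, map_pow, Polynomial.aeval_X, hν, complexify,
      MonoidAlgebra.coeff_mapRingHom, Units.val_pow_eq_pow_val, smul_eq_mul, mul_comm]
  have hc : (Nat.card H : ℂ)⁻¹ ≠ 0 := inv_ne_zero (by exact_mod_cast Nat.card_pos.ne')
  apply MonoidAlgebra.ext
  ext g
  rw [hcoef μ hi' g, MonoidAlgebra.coeff_zero, Finsupp.zero_apply]
  have h0 := hcoef l hi g
  rw [hX, MonoidAlgebra.coeff_zero, Finsupp.zero_apply] at h0
  have h1 := (mul_eq_zero.1 h0.symm).resolve_left hc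
  rw [← minpoly.dvd_iff, hmin, minpoly.dvd_iff] at h1
  rw [h1, mul_zero]

end Algebra

/-! ### Primitive central idempotents realized by Shoda pairs -/

section Idempotents

set_option linter.unusedSectionVars false

open Classical

variable {G : Type*} [Group G] [Fintype G]

open MonoidAlgebra (of)

section Trace

variable {R : Type*} [CommRing R]

/-- The sum of all conjugates, with multiplicities, of an element of the group algebra. -/
def conjTrace (y : MonoidAlgebra R G) : MonoidAlgebra R G := ∑ x : G, of R G x⁻¹ * y * of R G x

theorem mul_comm_of_forall_of {X : MonoidAlgebra R G} (h : ∀ g, X * of R G g = of R G g * X)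
    (z : MonoidAlgebra R G) : X * z = z * X := by
  induction z using MonoidAlgebra.induction_on with
  | of g => exact h g
  | add x y hx hy => rw [mul_add, add_mul, hx, hy]
  | smul r x hx => rw [mul_smul_comm, smul_mul_assoc, hx]

theorem conjTrace_mul_comm (y z : MonoidAlgebra R G) : conjTrace y * z = z * conjTrace y := by
  refine mul_comm_of_forall_of (fun g => ?_) z
  unfold conjTrace
  rw [Finset.sum_mul, Finset.mul_sum]
  refine Fintype.sum_equiv (Equiv.mulRight g) _ _ fun x => ?_
  simp only [Equiv.coe_mulRight, ← mul_assoc, ← map_mul, mul_inv_rev, mul_inv_cancel, one_mul]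
  simp only [mul_assoc, ← map_mul]

theorem mul_conjTrace {X : MonoidAlgebra R G} (hX : ∀ z, X * z = z * X) (y : MonoidAlgebra R G) :
    X * conjTrace y = conjTrace (X * y) := by
  unfold conjTrace
  rw [Finset.mul_sum]
  refine Finset.sum_congr rfl fun x _ => ?_
  rw [← mul_assoc, ← mul_assoc, hX, mul_assoc (of R G x⁻¹)]

theorem conjTrace_smul (r : R) (y : MonoidAlgebra R G) : conjTrace (r • y) = r • conjTrace y := by
  unfold conjTrace
  rw [Finset.smul_sum]
  exact Finset.sum_congr rfl fun x _ => by rw [mul_smul_comm, smul_mul_assoc]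

theorem conjTrace_sum {ι : Type*} (s : Finset ι) (f : ι → MonoidAlgebra R G) :
    conjTrace (∑ i ∈ s, f i) = ∑ i ∈ s, conjTrace (f i) := by
  unfold conjTrace
  rw [Finset.sum_comm]
  exact Finset.sum_congr rfl fun x _ => by rw [Finset.mul_sum, Finset.sum_mul]

theorem conjTrace_zero : conjTrace (0 : MonoidAlgebra R G) = 0 := by
  simp [conjTrace]

end Trace

theorem complexify_conjTrace (y : MonoidAlgebra ℚ G) :
    complexify (conjTrace y) = conjTrace (complexify y) := by
  simp only [conjTrace, map_sum, map_mul, complexify_of]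

theorem complexify_mul_comm {X : MonoidAlgebra ℚ G} (hX : ∀ z, X * z = z * X)
    (z : MonoidAlgebra ℂ G) : complexify X * z = z * complexify X :=
  mul_comm_of_forall_of (fun g => by rw [← complexify_of, ← map_mul, hX, map_mul]) z

theorem mem_of_fixes_of_isShodaPair {H K : Subgroup G} (h : IsShodaPair H K) {l : H →* ℂˣ}
    (hl : kerIn l = K) (g : G) (hg : Fixes g l) : g ∈ H := by
  refine h.2.2 g fun x hx hxg => ?_
  have ha : g⁻¹ * x * g ∈ H := by
    have := H.mul_mem hx hxg
    simpa [mul_assoc] using this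
  have e := hg ⟨_, ha⟩ ⟨x, hx⟩ (by simp [mul_assoc])
  rw [← hl]
  refine mem_kerIn.2 ⟨hxg, ?_⟩
  have e2 : (⟨_, hxg⟩ : H) = ⟨x, hx⟩⁻¹ * ⟨_, ha⟩ := Subtype.ext (by simp [mul_assoc])
  rw [e2, map_mul, map_inv, e, inv_mul_cancel]

/-- For `b = g a g⁻¹` one has `b g = g a`. Absorbing `b` on the left and `a` on the right gives two
different scalars. -/
theorem charIdem_mul_of_mul_charIdem {H : Subgroup G} {l : H →* ℂˣ} {g : G} (hg : ¬ Fixes g l) :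
    charIdem l * of ℂ G g * charIdem l = 0 := by
  simp only [Fixes, not_forall] at hg
  obtain ⟨a, b, hab, hne⟩ := hg
  have h1 : charIdem l * of ℂ G (b * g) * charIdem l =
      ((l b : ℂˣ) : ℂ) • (charIdem l * of ℂ G g * charIdem l) := by
    rw [map_mul, ← mul_assoc, charIdem_mul_of, smul_mul_assoc, smul_mul_assoc]
  have h2 : charIdem l * of ℂ G (b * g) * charIdem l =
      ((l a : ℂˣ) : ℂ) • (charIdem l * of ℂ G g * charIdem l) := by
    have : (b : G) * g = g * a := by rw [hab]; group
    rw [this, map_mul, ← mul_assoc, mul_assoc, of_mul_charIdem, mul_smul_comm]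
  have h3 : (((l b : ℂˣ) : ℂ) - ((l a : ℂˣ) : ℂ)) •
      (charIdem l * of ℂ G g * charIdem l) = 0 := by
    rw [sub_smul, ← h1, h2, sub_self]
  refine (smul_eq_zero.1 h3).resolve_left fun h => hne (Units.ext (sub_eq_zero.1 h))

variable {H : Subgroup G} {l : H →* ℂˣ}

theorem exists_charIdem_mul_mul (hl : ∀ g, Fixes g l → g ∈ H) (x : MonoidAlgebra ℂ G) :
    ∃ c : ℂ, charIdem l * x * charIdem l = c • charIdem l := by
  induction x using MonoidAlgebra.induction_on with
  | of g =>
    by_cases hg : Fixes g l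
    · refine ⟨((l ⟨g, hl g hg⟩ : ℂˣ) : ℂ), ?_⟩
      have := charIdem_mul_of l ⟨g, hl g hg⟩
      rw [this, smul_mul_assoc, charIdem_mul_self]
    · exact ⟨0, by rw [charIdem_mul_of_mul_charIdem hg, zero_smul]⟩
  | add x y hx hy =>
    obtain ⟨c, hc⟩ := hx
    obtain ⟨d, hd⟩ := hy
    exact ⟨c + d, by rw [mul_add, add_mul, hc, hd, add_smul]⟩
  | smul r x hx =>
    obtain ⟨c, hc⟩ := hx
    exact ⟨r * c, by rw [mul_smul_comm, smul_mul_assoc, hc, smul_smul]⟩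

theorem exists_central_mul_charIdem (hl : ∀ g, Fixes g l → g ∈ H) {X : MonoidAlgebra ℂ G}
    (hX : ∀ z, X * z = z * X) : ∃ c : ℂ, X * charIdem l = c • charIdem l := by
  obtain ⟨c, hc⟩ := exists_charIdem_mul_mul hl X
  refine ⟨c, ?_⟩
  rw [← hc, ← hX, mul_assoc, charIdem_mul_self]

/-- The conjugate by `x` contributes `e_l` if `x ∈ H`, and nothing otherwise. -/
theorem conjTrace_charIdem_mul_self (hl : ∀ g, Fixes g l → g ∈ H) :
    conjTrace (charIdem l) * charIdem l = (Nat.card H : ℂ) • charIdem l := by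
  have h : ∀ x : G, of ℂ G x⁻¹ * charIdem l * of ℂ G x * charIdem l =
      if x ∈ H then charIdem l else 0 := by
    intro x
    split_ifs with hx
    · have h1 := charIdem_mul_of l ⟨x, hx⟩
      have h2 := of_mul_charIdem l ⟨x, hx⟩⁻¹
      rw [mul_assoc (of ℂ G x⁻¹), h1, mul_smul_comm, smul_mul_assoc, mul_assoc,
        charIdem_mul_self]
      refine (congrArg _ h2).trans ?_
      rw [smul_smul, ← Units.val_mul, ← map_mul, mul_inv_cancel, map_one, Units.val_one, one_smul]
    · rw [mul_assoc, mul_assoc, ← mul_assoc (charIdem l),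
        charIdem_mul_of_mul_charIdem (mt (hl x) hx), mul_zero]
  rw [conjTrace, Finset.sum_mul, Finset.sum_congr rfl fun x _ => h x, ← Finset.sum_filter,
    Finset.sum_const, ← Nat.cast_smul_eq_nsmul ℂ]
  congr 2
  rw [Nat.card_eq_fintype_card, Fintype.card_subtype]

/-- The trace `T` of `e_μ` satisfies `T² = |H| T`, so the scalar by which it acts is 0 or `|H|`.
What matters later is that it is rational and nonnegative. -/
theorem conjTrace_charIdem_mul_charIdem {μ : H →* ℂˣ} (hl : ∀ g, Fixes g l → g ∈ H)
    (hμ : ∀ g, Fixes g μ → g ∈ H) :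
    ∃ n : ℕ, conjTrace (charIdem μ) * charIdem l = ((Nat.card H * n : ℕ) : ℂ) • charIdem l := by
  obtain ⟨c, hc⟩ := exists_central_mul_charIdem hl (conjTrace_mul_comm (charIdem μ))
  have hsq : conjTrace (charIdem μ) * conjTrace (charIdem μ) =
      (Nat.card H : ℂ) • conjTrace (charIdem μ) := by
    rw [mul_conjTrace (conjTrace_mul_comm _), conjTrace_charIdem_mul_self hμ, conjTrace_smul]
  have h1 : (c * c - Nat.card H * c) • charIdem l = 0 := by
    have h0 : conjTrace (charIdem μ) * conjTrace (charIdem μ) * charIdem l =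
        (c * c) • charIdem l := by
      rw [mul_assoc, hc, mul_smul_comm, hc, smul_smul]
    rw [hsq, smul_mul_assoc, hc, smul_smul] at h0
    rw [sub_smul, h0, sub_self]
  have h2 := (smul_eq_zero.1 h1).resolve_right (charIdem_ne_zero l)
  rw [← sub_mul] at h2
  rcases mul_eq_zero.1 h2 with h | h
  · exact ⟨1, by rw [hc, sub_eq_zero.1 h, mul_one]⟩
  · exact ⟨0, by rw [hc, h]; simp⟩

theorem commutator_le_kerIn (l : H →* ℂˣ) : ⁅H, H⁆ ≤ kerIn l := by
  refine Subgroup.commutator_le.2 fun a ha b hb => mem_kerIn.2 ⟨?_, ?_⟩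
  · exact H.mul_mem (H.mul_mem (H.mul_mem ha hb) (H.inv_mem ha)) (H.inv_mem hb)
  · change l ⁅(⟨a, ha⟩ : H), (⟨b, hb⟩ : H)⁆ = 1
    rw [map_commutatorElement, commutatorElement_eq_one_iff_mul_comm, mul_comm]

/-- `ε(H, ker l)` is a sum of idempotents of characters with the kernel of `l`, and a rational `X`
kills all of them together. -/
theorem mul_eps_eq_zero {X : MonoidAlgebra ℚ G} (hX : complexify X * charIdem l = 0) :
    X * eps H (kerIn l) = 0 := by
  obtain ⟨S, hS, e⟩ := complexify_eps (kerIn_le l) (commutator_le_kerIn l)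
  apply complexify_injective
  rw [map_mul, e, Finset.mul_sum, map_zero]
  exact Finset.sum_eq_zero fun μ hμ => mul_charIdem_eq_zero_of_kerIn_eq (hS μ hμ).symm hX

theorem mul_conjTrace_eps_eq_zero {X : MonoidAlgebra ℚ G} (hXc : ∀ z, X * z = z * X)
    (hX : complexify X * charIdem l = 0) : X * conjTrace (eps H (kerIn l)) = 0 := by
  rw [mul_conjTrace hXc, mul_eps_eq_zero hX, conjTrace_zero]

theorem exists_conjTrace_eps_mul_charIdem (h : IsShodaPair H (kerIn l)) :
    ∃ q : ℚ, 0 < q ∧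
      complexify (conjTrace (eps H (kerIn l))) * charIdem l = (q : ℂ) • charIdem l := by
  obtain ⟨S, hS, e⟩ := complexify_eps (kerIn_le l) (commutator_le_kerIn l)
  have hl := mem_of_fixes_of_isShodaPair h rfl
  have hlS : l ∈ S := by
    by_contra hn
    have h1 := eps_mul_charIdem (le_refl (kerIn l))
    rw [if_pos rfl, e, Finset.sum_mul, Finset.sum_eq_zero] at h1
    · exact charIdem_ne_zero l h1.symm
    · intro φ hφ
      exact charIdem_mul_eq_zero fun e => hn (e ▸ hφ)
  -- Off `S` the value 0 is a dummy that lets `choose` produce a total function; the value 1 at `l`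
  -- makes the sum positive.
  have hn : ∀ φ : H →* ℂˣ, ∃ n : ℕ, (φ ∈ S → conjTrace (charIdem φ) * charIdem l =
      ((Nat.card H * n : ℕ) : ℂ) • charIdem l) ∧ (φ = l → 0 < n) := by
    intro φ
    by_cases hφ : φ = l
    · subst hφ
      exact ⟨1, fun _ => by rw [conjTrace_charIdem_mul_self hl, mul_one], fun _ => one_pos⟩
    · by_cases hφS : φ ∈ S
      · obtain ⟨n, hn⟩ := conjTrace_charIdem_mul_charIdem hl
          (mem_of_fixes_of_isShodaPair h (hS φ hφS))
        exact ⟨n, fun _ => hn, fun e => absurd e hφ⟩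
      · exact ⟨0, fun h => absurd h hφS, fun e => absurd e hφ⟩
  choose n hn hpos using hn
  refine ⟨((∑ φ ∈ S, Nat.card H * n φ : ℕ) : ℚ), ?_, ?_⟩
  · exact_mod_cast Finset.sum_pos' (fun _ _ => Nat.zero_le _)
      ⟨l, hlS, Nat.mul_pos Nat.card_pos (hpos l rfl)⟩
  · rw [complexify_conjTrace, e, conjTrace_sum, Finset.sum_mul,
      Finset.sum_congr rfl fun φ hφ => hn φ hφ, ← Finset.sum_smul]
    congr 1
    push_cast
    rfl

/-- Each distinct conjugate occurs equally often: all fibres of `F` are translates of the stabilizer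
of `ε(H, K)`. -/
theorem conjTrace_eps_eq_smul_conjSum (H K : Subgroup G) :
    ∃ m : ℚ, conjTrace (eps H K) = m • conjSum H K := by
  let F : G → MonoidAlgebra ℚ G := fun g => of ℚ G g⁻¹ * eps H K * of ℚ G g
  have hF : ∀ x g, F (x * g) = of ℚ G g⁻¹ * F x * of ℚ G g := by
    intro x g
    simp only [F, mul_inv_rev, map_mul, mul_assoc]
  refine ⟨((Finset.univ.filter fun x => F x = F 1).card : ℚ), ?_⟩
  change ∑ x, F x = _ • ∑ f ∈ Finset.univ.image F, f
  have h := Finset.sum_comp (s := Finset.univ) (fun f : MonoidAlgebra ℚ G => f) F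
  rw [h, Finset.smul_sum]
  refine Finset.sum_congr rfl fun y hy => ?_
  obtain ⟨g, -, rfl⟩ := Finset.mem_image.1 hy
  rw [Nat.cast_smul_eq_nsmul]
  congr 1
  refine Finset.card_bij (fun x _ => x * g⁻¹) ?_ ?_ ?_
  · intro x hx
    have hx' : F x = F g := by simpa using hx
    refine Finset.mem_filter.2 ⟨Finset.mem_univ _, ?_⟩
    rw [hF, hx', ← hF, mul_inv_cancel]
  · intro x _ y _ hxy
    simpa using hxy
  · intro x hx
    have hx' : F x = F 1 := by simpa using hx
    refine ⟨x * g, Finset.mem_filter.2 ⟨Finset.mem_univ _, ?_⟩, by simp⟩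
    rw [hF, hx', ← hF, one_mul]

/-- A Shoda pair realizes a primitive central idempotent. -/
theorem exists_realizes_of_isShodaPair (h : IsShodaPair H (kerIn l)) :
    ∃ f : MonoidAlgebra ℚ G, Realizes H (kerIn l) f ∧
      complexify f * charIdem l = charIdem l := by
  obtain ⟨q, hq, e⟩ := exists_conjTrace_eps_mul_charIdem h
  obtain ⟨m, hm⟩ := conjTrace_eps_eq_smul_conjSum H (kerIn l)
  have hl := mem_of_fixes_of_isShodaPair h rfl
  set T := conjTrace (eps H (kerIn l)) with hT
  have hTc : ∀ z, T * z = z * T := conjTrace_mul_comm _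
  have hfe : complexify (q⁻¹ • T) * charIdem l = charIdem l := by
    have hq' : (q : ℂ) ≠ 0 := by exact_mod_cast hq.ne'
    rw [complexify_smul, smul_mul_assoc, e, smul_smul]
    push_cast
    rw [inv_mul_cancel₀ hq', one_smul]
  have hfc : ∀ z, (q⁻¹ • T) * z = z * (q⁻¹ • T) := fun z => by
    rw [smul_mul_assoc, hTc, mul_smul_comm]
  -- The rational central element `T - q` kills `e_l`, hence also `ε` and its trace `T`.
  have hTT : T * T = q • T := by
    have h1 : (T - q • 1) * T = 0 := by
      refine mul_conjTrace_eps_eq_zero (fun z => ?_) ?_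
      · rw [sub_mul, mul_sub, hTc, smul_mul_assoc, mul_smul_comm, one_mul, mul_one]
      · rw [map_sub, complexify_smul, map_one, sub_mul, e, smul_mul_assoc, one_mul, sub_self]
    rw [sub_mul, smul_mul_assoc, one_mul] at h1
    exact sub_eq_zero.1 h1
  have kill : ∀ f₁ : MonoidAlgebra ℚ G, IsCentralIdempotent f₁ →
      complexify f₁ * charIdem l = 0 → f₁ * (q⁻¹ • T) = 0 := by
    intro f₁ h1 h2
    rw [mul_smul_comm, mul_conjTrace_eps_eq_zero h1.2 h2, smul_zero]
  refine ⟨q⁻¹ • T, ⟨⟨⟨?_, hfc⟩, ?_, ?_⟩, q⁻¹ * m, by rw [hm, smul_smul]⟩, hfe⟩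
  · change (q⁻¹ • T) * (q⁻¹ • T) = q⁻¹ • T
    rw [smul_mul_assoc, mul_smul_comm, hTT, smul_smul q⁻¹ q, inv_mul_cancel₀ hq.ne', one_smul]
  · intro h0
    rw [h0, map_zero, zero_mul] at hfe
    exact charIdem_ne_zero l hfe.symm
  · intro f₁ f₂ h1 h2 h12 hsum
    obtain ⟨c₁, hc₁⟩ := exists_central_mul_charIdem hl (complexify_mul_comm h1.2)
    obtain ⟨c₂, hc₂⟩ := exists_central_mul_charIdem hl (complexify_mul_comm h2.2)
    -- Orthogonality forces one summand to act on `e_l` by 0; it then kills the whole idempotent, of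
    -- which it is a part.
    have h3 : (c₂ * c₁) • charIdem l = 0 := by
      rw [mul_smul, ← hc₁, ← mul_smul_comm, ← hc₂, ← mul_assoc, ← map_mul, h12, map_zero, zero_mul]
    rcases mul_eq_zero.1 ((smul_eq_zero.1 h3).resolve_right (charIdem_ne_zero l)) with hc | hc
    · right
      have h4 := kill f₂ h2 (by rw [hc₂, hc, zero_smul])
      rwa [hsum, mul_add, h2.2 f₁, h12, zero_add, h2.1.eq] at h4
    · left
      have h4 := kill f₁ h1 (by rw [hc₁, hc, zero_smul])
      rwa [hsum, mul_add, h12, add_zero, h1.1.eq] at h4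

theorem IsPrimitiveCentralIdempotent.mul_eq_self {R : Type*} [Ring R] {f e : R}
    (hf : IsPrimitiveCentralIdempotent f) (he : IsCentralIdempotent e) (h : f * e ≠ 0) :
    f * e = f := by
  have hff := hf.1.1.eq
  have hee := he.1.eq
  have hfe : f * e * (f * e) = f * e := by
    rw [mul_assoc, ← mul_assoc e f e, ← hf.1.2 e, mul_assoc f e e, hee, ← mul_assoc, hff]
  have hc : ∀ x, f * e * x = x * (f * e) := fun x => by
    rw [mul_assoc, he.2, ← mul_assoc, hf.1.2, mul_assoc]
  have hfl : f * (f * e) = f * e := by rw [← mul_assoc, hff]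
  have hfr : f * e * f = f * e := by rw [hc, hfl]
  have h2 : IsCentralIdempotent (f - f * e) := by
    refine ⟨?_, fun x => by rw [sub_mul, mul_sub, hf.1.2, hc]⟩
    change (f - f * e) * (f - f * e) = f - f * e
    rw [sub_mul, mul_sub, mul_sub, hff, hfl, hfr, hfe, sub_self, sub_zero]
  have h3 : f * e * (f - f * e) = 0 := by rw [mul_sub, hfr, hfe, sub_self]
  rcases hf.2.2 (f * e) (f - f * e) ⟨hfe, hc⟩ h2 h3 (add_sub_cancel _ _).symm with h1 | h1
  · exact absurd h1 h
  · exact (sub_eq_zero.1 h1).symm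

theorem IsPrimitiveCentralIdempotent.eq_of_mul_ne_zero {R : Type*} [Ring R] {e f : R}
    (he : IsPrimitiveCentralIdempotent e) (hf : IsPrimitiveCentralIdempotent f)
    (h : e * f ≠ 0) : e = f := by
  rw [← he.mul_eq_self hf.1 h, he.1.2 f]
  exact hf.mul_eq_self he.1 (by rwa [← he.1.2 f])

/-- A cyclic group of order `n` is isomorphic to the complex `n`-th roots of unity. -/
theorem exists_kerIn_eq {H K : Subgroup G} (h : IsShodaPair H K) :
    ∃ l : H →* ℂˣ, kerIn l = K := by
  obtain ⟨hKH, ⟨hn, hc⟩, -⟩ := h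
  have : NeZero (Nat.card (H ⧸ K.subgroupOf H)) := ⟨Nat.card_pos.ne'⟩
  let e : (H ⧸ K.subgroupOf H) ≃* rootsOfUnity (Nat.card (H ⧸ K.subgroupOf H)) ℂ :=
    mulEquivOfCyclicCardEq (Complex.card_rootsOfUnity _).symm
  refine ⟨((Subgroup.subtype _).comp e.toMonoidHom).comp (QuotientGroup.mk' _), ?_⟩
  ext g
  rw [mem_kerIn]
  have key : ∀ x : H, ((Subgroup.subtype _).comp e.toMonoidHom).comp (QuotientGroup.mk' _) x = 1 ↔
      (x : G) ∈ K := by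
    intro x
    change ((e (x : H ⧸ K.subgroupOf H) : rootsOfUnity _ ℂ) : ℂˣ) = 1 ↔ _
    rw [OneMemClass.coe_eq_one, EmbeddingLike.map_eq_one_iff, QuotientGroup.eq_one_iff]
    rfl
  exact ⟨fun ⟨h1, h2⟩ => (key ⟨g, h1⟩).1 h2, fun hg => ⟨hKH hg, (key ⟨g, hKH hg⟩).2 hg⟩⟩

end Idempotents

/-! ### Descent to a leaf that realizes a given idempotent -/

section Leaves

set_option linter.unusedSectionVars false

open Classical

variable {G : Type*} [Group G] [Fintype G]

open MonoidAlgebra (of)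

/-- Applying `σ` to coefficients and conjugating by `k` carries `e_ψ` to `e_φ`; the first fixes `X`
because it is rational, the second because it is central. -/
theorem complexify_mul_charIdem_ne_zero_of_sameOrbit {u : LinearTriple G} {B : Subgroup G}
    (hB : NormalIn B u.H) {ψ φ : B →* ℂˣ} (h : SameOrbit u ψ φ) {X : MonoidAlgebra ℚ G}
    (hXc : ∀ z, X * z = z * X) (hX : complexify X * charIdem φ ≠ 0) :
    complexify X * charIdem ψ ≠ 0 := by
  obtain ⟨σ, -, k, hk, hσ⟩ := h
  let S : MonoidAlgebra ℂ G →+* MonoidAlgebra ℂ G := MonoidAlgebra.mapRingHom G (σ : ℂ →+* ℂ)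
  have hSX : S (complexify X) = complexify X := by
    apply MonoidAlgebra.ext
    ext g
    simp [S, complexify, MonoidAlgebra.coeff_mapRingHom]
  have hconj : of ℂ G k⁻¹ * S (charIdem ψ) * of ℂ G k = charIdem φ := by
    apply MonoidAlgebra.ext
    ext g
    have h1 : (of ℂ G k⁻¹ * S (charIdem ψ) * of ℂ G k).coeff g =
        σ ((charIdem ψ).coeff (k * g * k⁻¹)) := by
      simp [S, MonoidAlgebra.of_apply, MonoidAlgebra.coeff_mul_single_apply,
        MonoidAlgebra.coeff_single_mul_apply, MonoidAlgebra.coeff_mapRingHom, mul_assoc]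
    rw [h1, coeff_charIdem, coeff_charIdem]
    by_cases hg : g ∈ B
    · have hg' : k * g * k⁻¹ ∈ B := hB.2 k hk g hg
      rw [dif_pos hg, dif_pos hg', map_mul, map_inv₀, map_natCast]
      congr 1
      exact (hσ ⟨g, hg⟩⁻¹ ⟨_, hg'⟩⁻¹ (by simp [mul_assoc])).symm
    · have hg' : k * g * k⁻¹ ∉ B := fun h => hg (by
        have := hB.2 k⁻¹ (u.H.inv_mem hk) _ h
        simpa [mul_assoc] using this)
      rw [dif_neg hg, dif_neg hg', map_zero]
  intro h0
  refine hX ?_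
  have h2 : complexify X * S (charIdem ψ) = 0 := by
    rw [← hSX, ← map_mul, h0, map_zero]
  rw [← hconj, ← mul_assoc, ← mul_assoc, complexify_mul_comm hXc, mul_assoc (of ℂ G k⁻¹), h2,
    mul_zero, zero_mul]

theorem isCentralIdempotent_hat (M : Subgroup G) [hM : M.Normal] :
    IsCentralIdempotent (hat M) := by
  refine ⟨hat_mul_hat le_rfl, mul_comm_of_forall_of fun g => (of_mul_hat g fun h => ?_).symm⟩
  exact ⟨fun h' => by simpa [mul_assoc] using hM.conj_mem _ h' g⁻¹, fun h' => hM.conj_mem _ h' g⟩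

theorem le_kerIn_of_mul_hat_eq {H M : Subgroup G} {l : H →* ℂˣ} {f : MonoidAlgebra ℚ G}
    (hfc : ∀ z, f * z = z * f) (hfl : complexify f * charIdem l = charIdem l)
    (hfM : f * hat M = f) : M ≤ kerIn l := by
  intro m hm
  refine mem_kerIn_of_of_mul_charIdem ?_
  have h1 : of ℂ G m * complexify f = complexify f := by
    have h2 := of_mul_charIdem (1 : M →* ℂˣ) ⟨m, hm⟩
    rw [MonoidHom.one_apply, Units.val_one, one_smul] at h2
    rw [← hfM, map_mul, complexify_hat, ← mul_assoc, ← complexify_mul_comm hfc, mul_assoc, h2]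
  rw [← hfl, ← mul_assoc, h1]

theorem normalCore_kerIn_of_isNLinear {u : LinearTriple G} {N : Subgroup G} (h : u.IsNLinear N) :
    (kerIn u.θ).normalCore = N :=
  SetLike.coe_injective ((inducedKer_eq_normalCore u.θ).symm.trans h)

variable {N : Subgroup G} {c : CliffordChoice G} {f : MonoidAlgebra ℚ G}

theorem exists_adj_mul_charIdem_ne_zero (hf : IsPrimitiveCentralIdempotent f)
    (hfN : ∀ M : Subgroup G, M.Normal → f * hat M = f → M ≤ N)
    (u : {u : LinearTriple G // u.IsNLinear N}) (hu : u.1.H ≠ u.1.A)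
    (hfu : complexify f * charIdem u.1.θ ≠ 0) :
    ∃ v, (tripleDigraph c N).Adj u v ∧ complexify f * charIdem v.1.θ ≠ 0 := by
  have hB := c.sub_spec u.1
  have hAB := LinearTriple.le_of_isMaxAbelianOver hB
  obtain ⟨φ, hφ, hfφ⟩ := exists_extension_mul_ne_zero hAB hB.1.2.2 hfu
  -- With `M` the core of `ker φ`, `hat M` fixes `e_φ`, so `f * hat M ≠ 0` and primitivity gives `f
  -- * hat M = f`, hence `M ≤ N`. Conversely `N ≤ ker θ ≤ ker φ`.
  have hφker : (kerIn φ).normalCore = N := by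
    refine le_antisymm (hfN _ inferInstance (hf.mul_eq_self (isCentralIdempotent_hat _) ?_)) ?_
    · intro h0
      have h1 := hat_mul_charIdem (((kerIn φ).normalCore_le).trans (kerIn_le φ)) φ
      rw [if_pos (kerIn φ).normalCore_le] at h1
      rw [← h1, ← mul_assoc, ← map_mul, h0, map_zero, zero_mul] at hfφ
      exact hfφ rfl
    · exact (normalCore_kerIn_of_isNLinear u.2).ge.trans (Subgroup.normal_le_normalCore.2
        ((Subgroup.normalCore_le _).trans (kerIn_mono hAB hφ)))
  have hmem : φ ∈ linAbove u.1 (c.sub u.1) :=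
    ⟨⟨hAB, hφ⟩, by rw [inducedKer_eq_normalCore, hφker]; exact u.2.symm⟩
  obtain ⟨ψ, ⟨hψ, hψφ⟩, -⟩ := c.reps_spec u.1 φ hmem
  refine ⟨⟨inertiaTriple hB.1.1 ψ (fixes_of_mem ψ), ?_⟩, ⟨hu, ψ, hψ, rfl⟩,
    complexify_mul_charIdem_ne_zero_of_sameOrbit hB.1.1 hψφ hf.1.2 hfφ⟩
  exact ((c.reps_subset u.1 hψ).2).trans u.2

theorem exists_leaf_mul_charIdem_ne_zero (hG : ClassC G) (hf : IsPrimitiveCentralIdempotent f)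
    (hfN : ∀ M : Subgroup G, M.Normal → f * hat M = f → M ≤ N)
    (u : {u : LinearTriple G // u.IsNLinear N}) (hfu : complexify f * charIdem u.1.θ ≠ 0) :
    ∃ v, Relation.ReflTransGen (tripleDigraph c N).Adj u v ∧ v.1.H = v.1.A ∧
      complexify f * charIdem v.1.θ ≠ 0 := by
  -- The descent terminates because `|A|` grows strictly along edges and is bounded by `|G|`.
  induction hn : Nat.card G - Nat.card u.1.A using Nat.strong_induction_on generalizing u with
  | _ n ih =>
    by_cases hu : u.1.H = u.1.A
    · exact ⟨u, Relation.ReflTransGen.refl, hu, hfu⟩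
    · obtain ⟨v, huv, hfv⟩ := exists_adj_mul_charIdem_ne_zero (c := c) hf hfN u hu hfu
      have h1 := card_lt_of_adj hG u v huv
      have h2 := Subgroup.card_le_card_group v.1.A
      obtain ⟨w, hvw, hw⟩ := ih _ (by omega) v hfv rfl
      exact ⟨w, hvw.head huv, hw⟩

theorem exists_leaf_realizes (hG : ClassC G) (c : CliffordChoice G) {H K : Subgroup G}
    (h : IsShodaPair H K) :
    ∃ v : TreeVertex c K.normalCore, IsSink (treeDigraph c K.normalCore) v ∧
      v.1.1.H = v.1.1.A ∧
      ∃ f : MonoidAlgebra ℚ G, Realizes H K f ∧ Realizes v.1.1.H (kerIn v.1.1.θ) f := by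
  obtain ⟨l, rfl⟩ := exists_kerIn_eq h
  obtain ⟨f, hf, hfl⟩ := exists_realizes_of_isShodaPair h
  have hfN : ∀ M : Subgroup G, M.Normal → f * hat M = f → M ≤ (kerIn l).normalCore :=
    fun M _ hM => Subgroup.normal_le_normalCore.2 (le_kerIn_of_mul_hat_eq hf.1.1.2 hfl hM)
  -- The idempotent of the core of `ker l` absorbs into `e_l`, and `f e_l = e_l ≠ 0`.
  have hroot : complexify f * charIdem (rootVertex (kerIn l).normalCore).1.θ ≠ 0 := by
    change complexify f * charIdem (1 : (kerIn l).normalCore →* ℂˣ) ≠ 0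
    intro h0
    have h1 := hat_mul_charIdem (((kerIn l).normalCore_le).trans (kerIn_le l)) l
    rw [if_pos (kerIn l).normalCore_le, complexify_hat] at h1
    rw [← h1, ← mul_assoc, h0, zero_mul, h1] at hfl
    exact charIdem_ne_zero l hfl.symm
  obtain ⟨v, hv, hvA, hfv⟩ := exists_leaf_mul_charIdem_ne_zero (c := c) hG hf.1 hfN _ hroot
  refine ⟨⟨v, hv⟩, fun w hw => ?_, hvA, f, hf, ?_⟩
  · exact (show w.1.1 ∈ c.Cl v.1 from hw).1 hvA
  · have hS := isShodaPair_of_reachable hv hvA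
    change Realizes v.1.H (kerIn v.1.θ) f
    rw [hvA] at hS ⊢
    obtain ⟨f', hf', hfl'⟩ := exists_realizes_of_isShodaPair hS
    -- `f'` fixes the idempotent at the leaf, which `f` does not kill; two primitive central
    -- idempotents with nonzero product are equal.
    have hne : f * f' ≠ 0 := by
      intro h0
      rw [← hfl', ← mul_assoc, ← map_mul, h0, map_zero, zero_mul] at hfv
      exact hfv rfl
    rwa [hf.1.eq_of_mul_ne_zero hf'.1 hne]

end Leaves

end ShodaTree

end

theorem theorem4p1 {G : Type*} [Group G] [Fintype G] (hG : ShodaTree.ClassC G)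
    (c : ShodaTree.CliffordChoice G) :
    (∀ (N : Subgroup G) [N.Normal],
      ShodaTree.IsRootedDirectedTree (ShodaTree.treeDigraph c N) (ShodaTree.treeRoot c N) ∧
      ∀ v : ShodaTree.TreeVertex c N, ShodaTree.IsSink (ShodaTree.treeDigraph c N) v →
        v.1.1.H = v.1.1.A → ShodaTree.IsShodaPair v.1.1.H (ShodaTree.kerIn v.1.1.θ)) ∧
    (∀ H' K' : Subgroup G, ShodaTree.IsShodaPair H' K' →
      ∃ v : ShodaTree.TreeVertex c K'.normalCore,
        ShodaTree.IsSink (ShodaTree.treeDigraph c K'.normalCore) v ∧ v.1.1.H = v.1.1.A ∧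
        ∃ f : MonoidAlgebra ℚ G, ShodaTree.Realizes H' K' f ∧
          ShodaTree.Realizes v.1.1.H (ShodaTree.kerIn v.1.1.θ) f) :=
  ⟨fun N _ => ⟨ShodaTree.isRootedDirectedTree_treeDigraph hG c N,
    fun v _ hv => ShodaTree.isShodaPair_of_reachable v.2 hv⟩,
    fun _ _ h => ShodaTree.exists_leaf_realizes hG c h⟩
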